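/- **Model.** Let $E$ (states) and $A$ (actions) be Borel spaces, i.e. homeomorphic to Borel subsets of Polish spaces, let $\mathcal Z$ be a measurable space and $N\in\mathbb N$ a horizon. For $n=0,\dots,N-1$ let $D_n\subseteq E\times A$ be measurable and contain the graph of a measurable map $E\to A$; write $D_n(x)=\{a:(x,a)\in D_n\}$. Let $T_n:D_n\times\mathcal Z\to E$ be measurable, $c_n:D_n\times E\to\mathbb R$ one-stage costs and $c_N:E\to\mathbb R$ a terminal cost. For $n=1,\dots,N$ let $\mathbb P_n$ be a separable probability measure on $\mathcal Z$. Fix $q\in(1,\infty]$, $\frac1p+\frac1q=1$, and for $n=1,\dots,N$ a non-empty set $\mathcal Q_n$ of probability measures $\mathbb Q\ll\mathbb P_n$ with $d\mathbb Q/d\mathbb P_n\in L^q(\mathbb P_n)$. Identify $\mathbb Q$ with its density and give $\mathcal Q_n$ the trace of the weak* topology $\sigma(L^q,L^p)$ and its Borel $\sigma$-algebra. Let $\mathcal H_n$ be the set of histories $h_n=(x_0,a_0,x_1,\dots,a_{n-1},x_n)$ with $a_k\in D_k(x_k)$. A randomized policy $\pi=(\pi_0,\dots,\pi_{N-1})$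 of the controller consists of stochastic kernels $\pi_n$ from $\mathcal H_n$ to $A$ with $\pi_n(D_n(x_n)\mid h_n)=1$ for all $h_n$. A policy $\gamma=(\gamma_0,\dots,\gamma_{N-1})\in\Gamma$ of nature consists of measurable maps (decision rules) $(h_n,a_n)\mapsto\gamma_n(\cdot\mid h_n,a_n)\in\mathcal Q_{n+1}$, defined for $h_n\in\mathcal H_n$, $a_n\in D_n(x_n)$. Under $(\pi,\gamma)$, given $H_n=h_n$, the action $A_n$ is drawn from $\pi_n(\cdot\mid h_n)$ and then $X_{n+1}=T_n(x_n,a_n,z)$ with $z$ drawn from $\gamma_n(\cdot\mid h_n,a_n)$. Put $$V_{n\pi\gamma}(h_n)=\mathbb E^{\pi\gamma}_{nh_n}\Big[\sum_{k=n}^{N-1}c_k(X_k,A_k,X_{k+1})+c_N(X_N)\Big],\qquad V_{n\pi}(h_n)=\sup_{\gamma\in\Gamma}V_{n\pi\gamma}(h_n),\qquad n=0,\dots,N,$$ where $\mathbb E^{\pi\gamma}_{nh_n}$ is the expectation under the law of the process started from the history $h_n$ at time $n$. For $v:\mathcal H_{n+1}\to\mathbb R$ let $$L_nv(h_n,a_n,\mathbb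 Q)=\int c_n\big(x_n,a_n,T_n(x_n,a_n,z)\big)+v\big(h_n,a_n,T_n(x_n,a_n,z)\big)\,\mathbb Q(dz),$$ $$\mathcal T_{n\pi_n\gamma_n}v(h_n)=\int L_nv\big(h_n,a,\gamma_n(\cdot\mid h_n,a)\big)\,\pi_n(da\mid h_n),\qquad \mathcal T_{n\pi_n}v(h_n)=\int\sup_{\mathbb Q\in\mathcal Q_{n+1}}L_nv(h_n,a,\mathbb Q)\,\pi_n(da\mid h_n).$$ **Assumptions.** For $n=0,\dots,N-1$: 1. All $D_n(x)$ are compact, and if $x_k\to x$ and $a_k\in D_n(x_k)$ then $(a_k)$ has an accumulation point in $D_n(x)$. The map $T_n(\cdot,\cdot,z)$ is continuous on $D_n$ for every $z$. The functions $c_n$ and $c_N$ are lower semicontinuous. 2. There are $\alpha,\underline\epsilon,\bar\epsilon\ge0$ with $\underline\epsilon+\bar\epsilon=1$, $\alpha\ne1$, and measurable $\underline b:E\to(-\infty,-\underline\epsilon]$, $\bar b:E\to[\bar\epsilon,\infty)$ (the same for all $n$) such that for all $\mathbb Q\in\mathcal Q_{n+1}$, $(x,a)\in D_n$, with $Z$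 distributed according to $\mathbb Q$, $$\mathbb E^{\mathbb Q}[-c_n^-(x,a,T_n(x,a,Z))]\ge\underline b(x),\quad \mathbb E^{\mathbb Q}[\underline b(T_n(x,a,Z))]\ge\alpha\underline b(x),$$ $$\mathbb E^{\mathbb Q}[c_n^+(x,a,T_n(x,a,Z))]\le\bar b(x),\quad \mathbb E^{\mathbb Q}[\bar b(T_n(x,a,Z))]\le\alpha\bar b(x),$$ and $\underline b\le c_N\le\bar b$. With $b=\bar b-\underline b$, every $(\bar x,\bar a)\in D_n$ has a neighbourhood $U$ in $D_n$ and measurable $\Theta_1,\Theta_2:\mathcal Z\to[0,\infty)$ in $L^p(\mathbb P_{n+1})$ with $|c_n(x,a,T_n(x,a,z))|\le\Theta_1(z)$ and $b(T_n(x,a,z))\le\Theta_2(z)$ for all $(x,a)\in U$, $z\in\mathcal Z$. 3. The densities of the measures in $\mathcal Q_1,\dots,\mathcal Q_N$ are bounded in $L^q$-norm by a common constant. **Theorem.** Let $\pi$ be a randomized policy of the controller. a) All expectations, integrals and suprema in the definitions of $V_{n\pi\gamma}$, $V_{n\pi}$ and $\mathcal T_{n\pi_n}V_{n+1,\pi}$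 are well-defined and finite. $V_{n\pi}$ is a measurable function on $\mathcal H_n$ for $n=0,\dots,N$, and $$V_{N\pi}(h_N)=c_N(x_N),\qquad V_{n\pi}(h_n)=\mathcal T_{n\pi_n}V_{n+1,\pi}(h_n),\quad h_n\in\mathcal H_n,\ n=0,\dots,N-1.$$ b) Suppose that, as a set of densities, $\mathcal Q_{n+1}$ is weak* closed in $L^q(\mathbb P_{n+1})$ for $n=0,\dots,N-1$. Then there exist maximizing decision rules of nature: there is $\gamma^*=(\gamma_0^*,\dots,\gamma_{N-1}^*)\in\Gamma$ such that, for all $n=0,\dots,N-1$, $\gamma^*_n(\cdot\mid h_n,a_n)$ attains $\sup_{\mathbb Q\in\mathcal Q_{n+1}}L_nV_{n+1,\pi}(h_n,a_n,\mathbb Q)$ for all $h_n\in\mathcal H_n$, $a_n\in D_n(x_n)$, and in particular $$\mathcal T_{n\pi_n\gamma_n^*}V_{n+1,\pi}=\mathcal T_{n\pi_n}V_{n+1,\pi}.\tag{$*$}$$ Moreover, every $\gamma^*\in\Gamma$ satisfying $(*)$ for all $n=0,\dots,N-1$ is an optimal response of nature to $\pi$, i.e. $V_{n\pi}=V_{n\pi\gamma^*}$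 for $n=0,\dots,N-1$. -/

import Mathlib

open MeasureTheory ProbabilityTheory Filter Topology
open scoped ENNReal NNReal

noncomputable section

namespace RobustMDP

/-! ### Dominated probability measures and the weak* topology -/

section Dominated

variable {Z : Type*} [MeasurableSpace Z]

/-- Probability measures that are absolutely continuous with respect to `P` and have a density
in `L^q(P)`. -/
structure DominatedMeasure (q : ℝ≥0∞) (P : Measure Z) where
  toMeasure : Measure Z
  isProb : IsProbabilityMeasure toMeasure
  absCont : toMeasure ≪ P
  memLp : MemLp (fun z => (toMeasure.rnDeriv P z).toReal) q P

attribute [instance] DominatedMeasure.isProb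

/-- The density, as an element of `L^q(P)`. -/
def DominatedMeasure.density {q : ℝ≥0∞} {P : Measure Z} (Q : DominatedMeasure q P) : Lp ℝ q P :=
  Q.memLp.toLp _

/-- The weak* topology `σ(L^q, L^p)` on `L^q(P)`, `p` being the exponent conjugate to `q`: the
coarsest topology for which `X ↦ ∫ X Y dP` is continuous for every `Y ∈ L^p(P)`. -/
@[reducible]
def weakStar (q : ℝ≥0∞) (P : Measure Z) : TopologicalSpace (Lp ℝ q P) :=
  TopologicalSpace.induced
    (fun (X : Lp ℝ q P) (Y : Lp ℝ q.conjExponent P) => ∫ z, X z * Y z ∂P) Pi.topologicalSpace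

/-- Dominated measures carry the trace of the weak* topology under the identification of a measure
with its density. -/
instance {q : ℝ≥0∞} {P : Measure Z} : TopologicalSpace (DominatedMeasure q P) :=
  TopologicalSpace.induced DominatedMeasure.density (weakStar q P)

/-- The Borel `σ`-algebra of the weak* topology. -/
instance {q : ℝ≥0∞} {P : Measure Z} : MeasurableSpace (DominatedMeasure q P) := borel _

instance {q : ℝ≥0∞} {P : Measure Z} : BorelSpace (DominatedMeasure q P) := ⟨rfl⟩

theorem DominatedMeasure.measurable_toMeasure {q : ℝ≥0∞} {P : Measure Z} [IsFiniteMeasure P] :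
    Measurable (fun Q : DominatedMeasure q P => Q.toMeasure) := by
  refine Measure.measurable_of_measurable_coe _ fun s hs => ?_
  let Y : Lp ℝ q.conjExponent P := indicatorConstLp _ hs (measure_ne_top P s) (1 : ℝ)
  have hcont : Continuous (fun Q : DominatedMeasure q P => ∫ z, Q.density z * Y z ∂P) := by
    have h1 : Continuous[weakStar q P, Pi.topologicalSpace]
        (fun (X : Lp ℝ q P) (Y : Lp ℝ q.conjExponent P) => ∫ z, X z * Y z ∂P) :=
      continuous_induced_dom
    have h2 : @Continuous _ _ _ (weakStar q P) (DominatedMeasure.density (q := q) (P := P)) :=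
      continuous_induced_dom
    exact (continuous_apply Y).comp (@Continuous.comp _ _ _ _ (weakStar q P) _ _ _ h1 h2)
  have heq : (fun Q : DominatedMeasure q P => Q.toMeasure s)
      = fun Q => ENNReal.ofReal (∫ z, Q.density z * Y z ∂P) := by
    funext Q
    have h1 : ∫ z, Q.density z * Y z ∂P = ∫ z in s, (Q.toMeasure.rnDeriv P z).toReal ∂P := by
      rw [← integral_indicator hs]
      refine integral_congr_ae ?_
      filter_upwards [Q.memLp.coeFn_toLp,
        (indicatorConstLp_coeFn : (Y : Z → ℝ) =ᵐ[P] _)] with z hz hY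
      rw [show Q.density z = _ from hz, hY]
      by_cases hzs : z ∈ s <;> simp [hzs]
    rw [h1, Measure.setIntegral_toReal_rnDeriv Q.absCont s]
    simp [Measure.real]
  rw [heq]
  exact hcont.measurable.ennreal_ofReal

end Dominated

/-! ### The decision model -/

/-- The data of a distributionally robust Markov decision model with horizon `N`, state space `E`,
action space `A` and disturbances in `Z`. The stages are `0, …, N - 1`; stagewise data are indexed
by `ℕ`, those with `n ≥ N` (and `P 0`, `Q 0`) are fillers that never enter. -/
structure Model (E A Z : Type*) [MeasurableSpace E] [MeasurableSpace A] [MeasurableSpace Z] where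
  /-- the planning horizon -/
  N : ℕ
  /-- the admissible state-action pairs -/
  D : ℕ → Set (E × A)
  measurableSet_D : ∀ n, MeasurableSet (D n)
  exists_selector : ∀ n, ∃ d : E → A, Measurable d ∧ ∀ x, (x, d x) ∈ D n
  /-- the transition functions -/
  T : ∀ n, D n → Z → E
  measurable_T : ∀ n, Measurable (fun y : D n × Z => T n y.1 y.2)
  /-- the one-stage costs `c_n(x, a, x')` -/
  c : ∀ n, D n → E → ℝ
  /-- the terminal cost -/
  cN : E → ℝ
  /-- `P n` is the reference law of the disturbance `Z_n`, `1 ≤ n ≤ N` -/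
  P : ℕ → Measure Z
  isProb : ∀ n, IsProbabilityMeasure (P n)
  /-- the integrability exponent of the densities -/
  q : ℝ≥0∞
  one_lt_q : 1 < q
  /-- `Q n` is the ambiguity set of the disturbance `Z_n`, `1 ≤ n ≤ N` -/
  Q : ∀ n, Set (DominatedMeasure q (P n))
  nonempty_Q : ∀ n, (Q n).Nonempty

attribute [instance] Model.isProb

namespace Model

variable {E A Z : Type*} [MeasurableSpace E] [MeasurableSpace A] [MeasurableSpace Z]
variable (M : Model E A Z)

/-- The exponent conjugate to `q`. -/
abbrev p : ℝ≥0∞ := M.q.conjExponent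

/-- The set `D_n(x)` of admissible actions. -/
abbrev sect (n : ℕ) (x : E) : Set A := {a | (x, a) ∈ M.D n}

/-- Feasible histories `(x_0, a_0, x_1, …, a_{n-1}, x_n)`, as the pair of the state sequence and the
action sequence. -/
abbrev Hist (n : ℕ) : Type _ :=
  {h : (Fin (n + 1) → E) × (Fin n → A) // ∀ k : Fin n, (h.1 k.castSucc, h.2 k) ∈ M.D k}

/-- The current state `x_n` of a history. -/
def last {n : ℕ} (h : M.Hist n) : E := h.1.1 (Fin.last n)

theorem measurable_last {n : ℕ} : Measurable (M.last : M.Hist n → E) :=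
  (measurable_pi_apply _).comp (measurable_fst.comp measurable_subtype_coe)

/-- Pairs of a feasible history `h_n` and an action `a_n ∈ D_n(x_n)`. -/
def histAct (n : ℕ) : Set (M.Hist n × A) := {k | (M.last k.1, k.2) ∈ M.D n}

/-- The type of pairs of a feasible history `h_n` and an action `a_n ∈ D_n(x_n)`. -/
abbrev HistAct (n : ℕ) : Type _ := M.histAct n

variable {M}

theorem measurableSet_histAct (n : ℕ) :
    MeasurableSet (M.histAct n) :=
  ((M.measurable_last.comp measurable_fst).prodMk measurable_snd) (M.measurableSet_D n)

/-- The current state-action pair `(x_n, a_n)`. -/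
def toD {n : ℕ} (k : M.HistAct n) : M.D n := ⟨(M.last k.1.1, k.1.2), k.2⟩

theorem measurable_toD {n : ℕ} : Measurable (toD : M.HistAct n → M.D n) :=
  ((M.measurable_last.comp (measurable_fst.comp measurable_subtype_coe)).prodMk
    (measurable_snd.comp measurable_subtype_coe)).subtype_mk

/-- The history `(h_n, a_n, x')`. -/
def extend {n : ℕ} (k : M.HistAct n) (x' : E) : M.Hist (n + 1) :=
  ⟨(Fin.snoc (α := fun _ => E) k.1.1.1.1 x', Fin.snoc (α := fun _ => A) k.1.1.1.2 k.1.2), by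
    intro j
    induction j using Fin.lastCases with
    | last =>
      simp only [Fin.snoc_castSucc, Fin.snoc_last, Fin.val_last]
      exact k.2
    | cast j =>
      simp only [Fin.snoc_castSucc, Fin.val_castSucc]
      exact k.1.1.2 j⟩

theorem measurable_extend {n : ℕ} :
    Measurable (fun y : M.HistAct n × E => extend y.1 y.2) := by
  have hk : Measurable (fun y : M.HistAct n × E => y.1.1) :=
    measurable_subtype_coe.comp measurable_fst
  have hh : Measurable (fun y : M.HistAct n × E => y.1.1.1.1) :=
    measurable_subtype_coe.comp (measurable_fst.comp hk)
  refine Measurable.subtype_mk (Measurable.prodMk ?_ ?_)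
  · refine measurable_pi_iff.2 fun j => ?_
    induction j using Fin.lastCases with
    | last =>
      simp only [Fin.snoc_last]
      exact measurable_snd
    | cast j =>
      simp only [Fin.snoc_castSucc]
      exact (measurable_pi_apply j).comp (measurable_fst.comp hh)
  · refine measurable_pi_iff.2 fun j => ?_
    induction j using Fin.lastCases with
    | last =>
      simp only [Fin.snoc_last]
      exact measurable_snd.comp hk
    | cast j =>
      simp only [Fin.snoc_castSucc]
      exact (measurable_pi_apply j).comp (measurable_snd.comp hh)

/-! ### Policies -/

variable (M)

/-- A randomized policy of the controller. -/
structure Policy where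
  kernel : ∀ n, Kernel (M.Hist n) A
  isMarkov : ∀ n, IsMarkovKernel (kernel n)
  feasible : ∀ n (h : M.Hist n), kernel n h (M.sect n (M.last h)) = 1

/-- A policy of nature: measurable decision rules from pairs `(h_n, a_n)` with `a_n ∈ D_n(x_n)` to
the ambiguity set of stage `n + 1`. -/
structure NaturePolicy where
  rule : ∀ n, M.HistAct n → M.Q (n + 1)
  measurable_rule : ∀ n, Measurable (rule n)

variable {M}

/-- The stochastic kernel from `(h_n, a_n)` to the disturbance `z_{n+1}` induced by nature. -/
def NaturePolicy.kernel (γ : M.NaturePolicy) (n : ℕ) : Kernel (M.HistAct n) Z where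
  toFun k := (γ.rule n k).1.toMeasure
  measurable' := DominatedMeasure.measurable_toMeasure.comp
    (measurable_subtype_coe.comp (γ.measurable_rule n))

/-- The transition kernel `Q_n^γ(B | h_n, a_n) = ∫ 1_B(T_n(x_n, a_n, z)) γ_n(dz | h_n, a_n)`. -/
def NaturePolicy.transition (γ : M.NaturePolicy) (n : ℕ) : Kernel (M.HistAct n) E :=
  (Kernel.id ×ₖ γ.kernel n).map (fun y => M.T n (toD y.1) y.2)

/-- The kernel `h_n ↦ law of (h_n, a_n)`, with `a_n` drawn from `π_n(· | h_n)`. -/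
def Policy.actKernel (π : M.Policy) (n : ℕ) : Kernel (M.Hist n) (M.HistAct n) :=
  (Kernel.id ×ₖ π.kernel n).comapRight
    (MeasurableEmbedding.subtype_coe (measurableSet_histAct n))

/-- The kernel `(h_n, a_n) ↦ law of (h_n, a_n, x_{n+1})`, with `x_{n+1}` drawn from `Q_n^γ`. -/
def NaturePolicy.stepKernel (γ : M.NaturePolicy) (n : ℕ) :
    Kernel (M.HistAct n) (M.Hist (n + 1)) :=
  (Kernel.id ×ₖ γ.transition n).map (fun y => extend y.1 y.2)

/-- The conditional law of `H_{n+k}` given `H_n = h_n` under the policies `π` and `γ`. -/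
def law (π : M.Policy) (γ : M.NaturePolicy) (n : ℕ) : ∀ k, Kernel (M.Hist n) (M.Hist (n + k))
  | 0 => Kernel.id
  | k + 1 => (γ.stepKernel (n + k) ∘ₖ π.actKernel (n + k)) ∘ₖ law π γ n k

/-! ### Values -/

variable (M)

/-- The total cost `∑_{n ≤ k < m} c_k(x_k, a_k, x_{k+1}) + c_N(x_m)` from stage `n` on, along a
history `(x_0, a_0, …, x_m)`. It is used with `m = N`. -/
def totalCost (n : ℕ) {m : ℕ} (h : M.Hist m) : ℝ :=
  (∑ k ∈ Finset.univ.filter (fun k : Fin m => n ≤ (k : ℕ)),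
    M.c k ⟨(h.1.1 k.castSucc, h.1.2 k), h.2 k⟩ (h.1.1 k.succ)) + M.cN (M.last h)

variable {M}

/-- The value `V_{nπγ}(h_n)`, `n ≤ N`: the conditional expectation, given `H_n = h_n`, of the total
cost from stage `n` on. -/
def Policy.value (π : M.Policy) (γ : M.NaturePolicy) (n : ℕ) (h : M.Hist n) : ℝ :=
  ∫ h', M.totalCost n h' ∂(law π γ n (M.N - n) h)

/-- The robust value `V_{nπ}(h_n) = sup_γ V_{nπγ}(h_n)`. -/
def Policy.robustValue (π : M.Policy) (n : ℕ) (h : M.Hist n) : ℝ :=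
  ⨆ γ : M.NaturePolicy, π.value γ n h

variable (M)

/-- `c_n(x_n, a_n, T_n(x_n, a_n, z)) + v(h_n, a_n, T_n(x_n, a_n, z))`. -/
def costToGo (n : ℕ) (v : M.Hist (n + 1) → ℝ) (k : M.HistAct n) (z : Z) : ℝ :=
  M.c n (toD k) (M.T n (toD k) z) + v (extend k (M.T n (toD k) z))

/-- `∫ c_n(x_n, a_n, T_n(x_n, a_n, z)) + v(h_n, a_n, T_n(x_n, a_n, z)) ℚ(dz)`. -/
def stageValue (n : ℕ) (v : M.Hist (n + 1) → ℝ) (k : M.HistAct n) (Q : M.Q (n + 1)) : ℝ :=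
  ∫ z, M.costToGo n v k z ∂Q.1.toMeasure

variable {M}

/-- The measure `π_n(· | h_n)` on the set `D_n(x_n)` of admissible actions, where it is
concentrated. -/
def Policy.onSect (π : M.Policy) (n : ℕ) (h : M.Hist n) : Measure (M.sect n (M.last h)) :=
  (π.kernel n h).comap Subtype.val

/-- The operator `𝒯_{nπ_nγ_n}`. -/
def Policy.opNature (π : M.Policy) (γ : M.NaturePolicy) (n : ℕ) (v : M.Hist (n + 1) → ℝ)
    (h : M.Hist n) : ℝ :=
  ∫ a, M.stageValue n v ⟨(h, a), a.2⟩ (γ.rule n ⟨(h, a), a.2⟩) ∂(π.onSect n h)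

/-- The operator `𝒯_{nπ_n}`, in which nature maximizes over the ambiguity set. -/
def Policy.op (π : M.Policy) (n : ℕ) (v : M.Hist (n + 1) → ℝ) (h : M.Hist n) : ℝ :=
  ∫ a, ⨆ Q : M.Q (n + 1), M.stageValue n v ⟨(h, a), a.2⟩ Q ∂(π.onSect n h)

/-! ### Assumptions -/

variable (M)

/-- The ambiguity set of stage `n`, seen as a set of densities, is weak* closed in `L^q`. -/
def WeakStarClosed (n : ℕ) : Prop :=
  IsClosed[weakStar M.q (M.P n)] (DominatedMeasure.density '' M.Q n)

/-- The continuity and compactness assumptions. -/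
structure ContinuityCompactness [TopologicalSpace E] [TopologicalSpace A] : Prop where
  isCompact_sect : ∀ n < M.N, ∀ x, IsCompact (M.sect n x)
  upperSemicontinuous_sect : ∀ n < M.N, ∀ (x : E) (xs : ℕ → E) (as : ℕ → A),
    Tendsto xs atTop (𝓝 x) → (∀ k, as k ∈ M.sect n (xs k)) →
    ∃ a ∈ M.sect n x, MapClusterPt a atTop as
  continuous_T : ∀ n < M.N, ∀ z, Continuous (fun y : M.D n => M.T n y z)
  lowerSemicontinuous_c : ∀ n < M.N, LowerSemicontinuous (fun y : M.D n × E => M.c n y.1 y.2)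
  lowerSemicontinuous_cN : LowerSemicontinuous M.cN

/-- The bounding assumptions. Expectations of functions of constant sign are written as Lebesgue
integrals in `[0, ∞]`; note that `ENNReal.ofReal (-r)` and `ENNReal.ofReal r` are the negative and
the positive part of `r`. -/
structure Bounding [TopologicalSpace E] [TopologicalSpace A] : Prop where
  exists_bounds : ∃ (α εl εu : ℝ) (bl bu : E → ℝ),
    0 ≤ α ∧ α ≠ 1 ∧ 0 ≤ εl ∧ 0 ≤ εu ∧ εl + εu = 1 ∧
    Measurable bl ∧ Measurable bu ∧ (∀ x, bl x ≤ -εl) ∧ (∀ x, εu ≤ bu x) ∧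
    (∀ n < M.N, ∀ Q ∈ M.Q (n + 1), ∀ y : M.D n,
      ∫⁻ z, ENNReal.ofReal (-M.c n y (M.T n y z)) ∂Q.toMeasure ≤ ENNReal.ofReal (-bl y.1.1) ∧
      ∫⁻ z, ENNReal.ofReal (-bl (M.T n y z)) ∂Q.toMeasure ≤ ENNReal.ofReal (α * -bl y.1.1) ∧
      ∫⁻ z, ENNReal.ofReal (M.c n y (M.T n y z)) ∂Q.toMeasure ≤ ENNReal.ofReal (bu y.1.1) ∧
      ∫⁻ z, ENNReal.ofReal (bu (M.T n y z)) ∂Q.toMeasure ≤ ENNReal.ofReal (α * bu y.1.1)) ∧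
    (∀ x, bl x ≤ M.cN x ∧ M.cN x ≤ bu x) ∧
    -- local domination in `L^p`, for the bounding function `b = bu - bl`
    (∀ n < M.N, ∀ y₀ : M.D n, ∃ Θ₁ Θ₂ : Z → ℝ,
      Measurable Θ₁ ∧ Measurable Θ₂ ∧ (∀ z, 0 ≤ Θ₁ z) ∧ (∀ z, 0 ≤ Θ₂ z) ∧
      MemLp Θ₁ M.p (M.P (n + 1)) ∧ MemLp Θ₂ M.p (M.P (n + 1)) ∧
      ∀ᶠ y in 𝓝 y₀, ∀ z, |M.c n y (M.T n y z)| ≤ Θ₁ z ∧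
        bu (M.T n y z) - bl (M.T n y z) ≤ Θ₂ z)
  norm_bounded : ∃ K : ℝ, ∀ n < M.N, ∀ Q ∈ M.Q (n + 1), ‖Q.density‖ ≤ K

end Model

end RobustMDP

end

/-!
The robust cost iteration `J_N = c_N`, `J_n = 𝒯_{nπ_n} J_{n+1}` (`optValue`) computes the robust
value because nature can maximize stage by stage.

*Bounds.* The function `b = bu - bl ≥ 1` satisfies `∫ |c_n| + C b dℚ ≤ (1 + C α) b(x_n)`. Hence
`|J_n| ≤ C_n b(x_n)`, and all costs are integrable under the law of the process
(`BoundedBy.iterValue_bound`, `BoundedBy.integrable_law`).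

*Measurability and selection.* For a measurable `v` with `|v| ≤ C b`, local domination puts the
integrand of `L_n v(h_n, a_n, ·)` into `L^p(P_{n+1})`, which is separable, and it depends
measurably on `(h_n, a_n)` there. The stage value is its pairing with the density of `ℚ`. As the
densities are norm-bounded, the supremum over `ℚ` is a Lipschitz function on `L^p`, hence
measurable in `(h_n, a_n)` (`measurable_iSup_integral`), and a countable partition of `L^p` into
small pieces gives measurable `ε`-maximizers for an arbitrary ambiguity set
(`exists_measurable_almost_maximizer`). If the ambiguity set is weak* closed, then it is compact
(`compactSpace_of_weakStarClosed`) and metrizable, and there is a measurable exact maximizer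
(`exists_measurable_argmax`, `exists_measurable_maximizer`).

*Verification.* The cost accumulated up to time `m` plus `J_m` is a supermartingale under every
policy of nature, so that `V_{nπγ} ≤ J_n`; under decision rules that lose at most `ε` per stage it
decreases by at most `ε` in expectation (`BoundedBy.integral_law_succ_optValue_le`,
`BoundedBy.integral_law_optValue_le_succ_add`). Small positive `ε` give `V_{nπ} = J_n`, and `ε =
0` gives the optimality of every maximizing response.
-/

noncomputable section

namespace RobustMDP

/-! ### Measurable selection of maximizers -/

/-- The supremum over a separable space of a function that is measurable in the parameter and
continuous in the variable is a countable supremum, hence measurable. -/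
theorem measurable_of_isLUB_range {Ω F : Type*} [MeasurableSpace Ω] [TopologicalSpace F]
    [TopologicalSpace.SeparableSpace F] [Nonempty F] {u : Ω → F → ℝ}
    (hmeas : ∀ y, Measurable fun ω => u ω y) (hcont : ∀ ω, Continuous (u ω)) {m : Ω → ℝ}
    (hm : ∀ ω, IsLUB (Set.range (u ω)) (m ω)) : Measurable m := by
  refine Measurable.isLUB (f := fun i ω => u ω (TopologicalSpace.denseSeq F i))
    (fun i => hmeas _) fun ω => ?_
  have hsub : Set.range (u ω) ⊆ closure (Set.range (u ω ∘ TopologicalSpace.denseSeq F)) := by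
    rw [Set.range_comp]
    exact (hcont ω).range_subset_closure_image_dense (TopologicalSpace.denseRange_denseSeq F)
  refine ⟨?_, fun b hb => (hm ω).2 fun r hr => ?_⟩
  · rintro r ⟨i, rfl⟩
    exact (hm ω).1 ⟨_, rfl⟩
  · have h1 : b ∈ upperBounds (closure (Set.range (u ω ∘ TopologicalSpace.denseSeq F))) := by
      rw [upperBounds_closure]
      exact hb
    exact h1 (hsub hr)

/-- Measurable maximum theorem for Carathéodory functions on a compact metrizable space. By the
Hausdorff–Alexandroff theorem the space is a continuous image of the Cantor set in `ℝ`, and the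
leftmost maximizer there depends measurably on the parameter: it is at most `a` if and only if the
maximum over the part of the Cantor set left of `a` equals the global maximum. -/
theorem exists_measurable_argmax {Ω K : Type*} [MeasurableSpace Ω] [TopologicalSpace K]
    [CompactSpace K] [TopologicalSpace.MetrizableSpace K] [Nonempty K] [MeasurableSpace K]
    [BorelSpace K] {u : Ω → K → ℝ} (hmeas : ∀ y, Measurable fun ω => u ω y)
    (hcont : ∀ ω, Continuous (u ω)) :
    ∃ s : Ω → K, Measurable s ∧ ∀ ω y, u ω y ≤ u ω (s ω) := by
  let _ := TopologicalSpace.metrizableSpaceMetric K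
  obtain ⟨g₀, hg₀, hsurj₀⟩ := exists_nat_bool_continuous_surjective_of_compact K
  let g : cantorSet → K := g₀ ∘ cantorSetHomeomorphNatToBool
  have hg : Continuous g := hg₀.comp cantorSetHomeomorphNatToBool.continuous
  have hsurj : Function.Surjective g := hsurj₀.comp cantorSetHomeomorphNatToBool.surjective
  have : CompactSpace cantorSet := isCompact_iff_compactSpace.1 isCompact_cantorSet
  have : Nonempty cantorSet := ⟨⟨0, zero_mem_cantorSet⟩⟩
  let w : Ω → cantorSet → ℝ := fun ω t => u ω (g t)
  have hw : ∀ ω, Continuous (w ω) := fun ω => (hcont ω).comp hg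
  have hmax : ∀ ω, ∃ t, ∀ t', w ω t' ≤ w ω t := fun ω => by
    obtain ⟨t, -, ht⟩ := isCompact_univ.exists_isMaxOn Set.univ_nonempty (hw ω).continuousOn
    exact ⟨t, fun t' => ht (Set.mem_univ t')⟩
  choose τ hτ using hmax
  have hm : Measurable fun ω => w ω (τ ω) :=
    measurable_of_isLUB_range (fun t => hmeas (g t)) hw fun ω =>
      IsGreatest.isLUB ⟨⟨_, rfl⟩, by rintro _ ⟨t, rfl⟩; exact hτ ω t⟩
  -- the leftmost maximizer in the Cantor set
  have hleast : ∀ ω, ∃ s, IsLeast {t | w ω t = w ω (τ ω)} s := fun ω =>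
    (isClosed_eq (hw ω) continuous_const).isCompact.exists_isLeast ⟨τ ω, rfl⟩
  choose s hs using hleast
  refine ⟨g ∘ s, hg.measurable.comp ?_, fun ω y => ?_⟩
  · refine Measurable.of_comap_le (le_of_eq_of_le (MeasurableSpace.comap_comp) ?_)
    refine Measurable.comap_le (measurable_of_Iic fun a => ?_)
    by_cases hF : Nonempty {t : cantorSet // (t : ℝ) ≤ a}
    · have : CompactSpace {t : cantorSet // (t : ℝ) ≤ a} :=
        isCompact_iff_compactSpace.1
          (isClosed_le continuous_subtype_val continuous_const).isCompact
      have hwF : ∀ ω, Continuous fun t : {t : cantorSet // (t : ℝ) ≤ a} => w ω t := fun ω =>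
        (hw ω).comp continuous_subtype_val
      have hmaxF : ∀ ω, ∃ t : {t : cantorSet // (t : ℝ) ≤ a},
          ∀ t' : {t : cantorSet // (t : ℝ) ≤ a}, w ω t' ≤ w ω t := fun ω => by
        obtain ⟨t, -, ht⟩ := isCompact_univ.exists_isMaxOn Set.univ_nonempty (hwF ω).continuousOn
        exact ⟨t, fun t' => ht (Set.mem_univ t')⟩
      choose σ hσ using hmaxF
      have hmF : Measurable fun ω => w ω (σ ω) :=
        measurable_of_isLUB_range (u := fun ω (t : {t : cantorSet // (t : ℝ) ≤ a}) => w ω t)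
          (fun t => hmeas (g t)) hwF fun ω =>
          IsGreatest.isLUB ⟨⟨_, rfl⟩, by rintro _ ⟨t, rfl⟩; exact hσ ω t⟩
      have heq : (Subtype.val ∘ s) ⁻¹' Set.Iic a = {ω | w ω (σ ω) = w ω (τ ω)} := by
        ext ω
        refine ⟨fun h => le_antisymm (hτ ω _) ?_, fun h => ?_⟩
        · rw [← show w ω (s ω) = w ω (τ ω) from (hs ω).1]
          exact hσ ω ⟨s ω, h⟩
        · exact le_trans (show ((s ω : cantorSet) : ℝ) ≤ _ from (hs ω).2 h) (σ ω).2
      rw [heq]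
      exact measurableSet_eq_fun hmF hm
    · convert MeasurableSet.empty
      ext ω
      exact ⟨fun h => hF ⟨⟨s ω, h⟩⟩, fun h => h.elim⟩
  · obtain ⟨t, rfl⟩ := hsurj y
    exact (hτ ω t).trans (hs ω).1.symm.le

/-! ### The duality pairing -/

instance fact_one_le_conjExponent (q : ℝ≥0∞) : Fact (1 ≤ q.conjExponent) := ⟨le_self_add⟩

theorem conjExponent_ne_top {q : ℝ≥0∞} (hq : 1 < q) : q.conjExponent ≠ ∞ := by
  simp [ENNReal.conjExponent, tsub_eq_zero_iff_le, hq]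

section Pairing

variable {Z : Type*} [MeasurableSpace Z] {q : ℝ≥0∞} [Fact (1 ≤ q)] {P : Measure Z}

/-- The duality pairing `(X, Y) ↦ ∫ X Y dP` of `L^q(P)` and `L^p(P)`. -/
def pairing (q : ℝ≥0∞) [Fact (1 ≤ q)] (P : Measure Z) :
    Lp ℝ q P →L[ℝ] Lp ℝ q.conjExponent P →L[ℝ] ℝ :=
  (ContinuousLinearMap.mul ℝ ℝ).lpPairing P q q.conjExponent

theorem pairing_apply (X : Lp ℝ q P) (Y : Lp ℝ q.conjExponent P) :
    pairing q P X Y = ∫ z, X z * Y z ∂P := by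
  simp [pairing, ContinuousLinearMap.lpPairing_eq_integral]

theorem abs_pairing_le {X : Lp ℝ q P} {K : ℝ} (hX : ‖X‖ ≤ K) (Y : Lp ℝ q.conjExponent P) :
    |pairing q P X Y| ≤ ‖pairing q P‖ * K * ‖Y‖ :=
  ((pairing q P).le_opNorm₂ X Y).trans (by gcongr)

variable [IsProbabilityMeasure P]

namespace DominatedMeasure

theorem integrable_of_memLp (Q : DominatedMeasure q P) {f : Z → ℝ}
    (hf : MemLp f q.conjExponent P) : Integrable f Q.toMeasure :=
  (integrable_rnDeriv_smul_iff Q.absCont).1 (Q.memLp.integrable_mul hf)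

theorem integral_eq_pairing (Q : DominatedMeasure q P) {f : Z → ℝ}
    (hf : MemLp f q.conjExponent P) :
    ∫ z, f z ∂Q.toMeasure = pairing q P Q.density (hf.toLp f) := by
  rw [pairing_apply, ← integral_rnDeriv_smul Q.absCont]
  refine integral_congr_ae ?_
  filter_upwards [Q.memLp.coeFn_toLp, hf.coeFn_toLp] with z h1 h2
  rw [h2, show Q.density z = _ from h1, smul_eq_mul]

theorem integral_coe_eq_pairing (Q : DominatedMeasure q P) (Y : Lp ℝ q.conjExponent P) :
    ∫ z, Y z ∂Q.toMeasure = pairing q P Q.density Y := by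
  rw [Q.integral_eq_pairing (Lp.memLp Y), Lp.toLp_coeFn]

omit [IsProbabilityMeasure P] in
/-- The topology of dominated measures, induced by that of the densities, is the one induced by all
pairings with functions in `L^p`. -/
theorem isInducing_pairing : IsInducing fun (Q : DominatedMeasure q P)
    (Y : Lp ℝ q.conjExponent P) => pairing q P Q.density Y := by
  constructor
  simp_rw [pairing_apply]
  exact induced_compose

omit [IsProbabilityMeasure P] in
theorem continuous_pairing (Y : Lp ℝ q.conjExponent P) :
    Continuous fun Q : DominatedMeasure q P => pairing q P Q.density Y :=
  (continuous_apply Y).comp isInducing_pairing.continuous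

theorem pairing_injective : Function.Injective fun (Q : DominatedMeasure q P)
    (Y : Lp ℝ q.conjExponent P) => pairing q P Q.density Y := by
  intro Q Q' h
  have h1 : Q.toMeasure = Q'.toMeasure := by
    ext s hs
    have := congrFun h (indicatorConstLp _ hs (measure_ne_top P s) (1 : ℝ))
    have key : ∀ Q : DominatedMeasure q P, pairing q P Q.density
        (indicatorConstLp _ hs (measure_ne_top P s) (1 : ℝ)) = Q.toMeasure.real s := fun Q => by
      rw [← Q.integral_coe_eq_pairing, integral_congr_ae (Q.absCont.ae_le indicatorConstLp_coeFn),
        integral_indicator hs]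
      simp
    simp only [key] at this
    exact (measureReal_eq_measureReal_iff).1 this
  cases Q; cases Q'; cases h1; rfl

end DominatedMeasure
end Pairing

/-! ### Setwise limits of measures -/

section Setwise
variable {Z ι : Type*} [MeasurableSpace Z] {P : Measure Z} [IsFiniteMeasure P]

/-- A setwise limit of measures along an ultrafilter exists, and is a measure if the measures are
uniformly absolutely continuous with respect to a finite measure `P`: the bound `φ (P s)` turns
finite additivity of the limit into countable additivity. -/
theorem exists_measure_setwise_limit (𝒰 : Ultrafilter ι) (μ : ι → Measure Z)
    {φ : ℝ≥0∞ → ℝ≥0∞} (hφ : Tendsto φ (𝓝 0) (𝓝 0))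
    (hμ : ∀ i s, MeasurableSet s → μ i s ≤ φ (P s)) :
    ∃ ν : Measure Z, ∀ s, MeasurableSet s → Tendsto (fun i => μ i s) 𝒰 (𝓝 (ν s)) := by
  have hlim : ∀ s, ∃ r, Tendsto (fun i => μ i s) 𝒰 (𝓝 r) := fun s =>
    ⟨_, (𝒰.map fun i => μ i s).le_nhds_lim⟩
  choose m hm using hlim
  have hbound : ∀ s, MeasurableSet s → m s ≤ φ (P s) := fun s hs =>
    le_of_tendsto (hm s) (Eventually.of_forall fun i => hμ i s hs)
  have hempty : m ∅ = 0 := tendsto_nhds_unique (hm ∅) (by simp)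
  have hunion : ∀ s t, MeasurableSet t → Disjoint s t → m (s ∪ t) = m s + m t := fun s t ht hst =>
    tendsto_nhds_unique (hm _) (((hm s).add (hm t)).congr fun i =>
      (measure_union hst ht).symm)
  have hUnion : ∀ f : ℕ → Set Z, (∀ i, MeasurableSet (f i)) →
      Pairwise (Function.onFun Disjoint f) → m (⋃ i, f i) = ∑' i, m (f i) := by
    intro f hf hdisj
    -- the tails `⋃ i ≥ n, f i` decrease to the empty set
    let tail : ℕ → Set Z := fun n => ⋃ i ∈ Set.Ici n, f i
    have htail_meas : ∀ n, MeasurableSet (tail n) := fun n =>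
      MeasurableSet.biUnion (Set.to_countable _) fun i _ => hf i
    have hsplit : ∀ n, m (⋃ i, f i) = ∑ i ∈ Finset.range n, m (f i) + m (tail n) := by
      intro n
      induction n with
      | zero => simp [tail]
      | succ n ih =>
        have h1 : tail n = f n ∪ tail (n + 1) := by
          ext z
          simp only [tail, Set.mem_Ici, Set.mem_iUnion, Set.mem_union, exists_prop]
          constructor
          · rintro ⟨i, hi, hz⟩
            rcases hi.eq_or_lt with rfl | h
            · exact Or.inl hz
            · exact Or.inr ⟨i, h, hz⟩
          · rintro (hz | ⟨i, hi, hz⟩)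
            · exact ⟨n, le_rfl, hz⟩
            · exact ⟨i, by omega, hz⟩
        have h2 : Disjoint (f n) (tail (n + 1)) := by
          simp only [tail, Set.disjoint_iUnion_right]
          exact fun i hi => hdisj (by simp at hi; omega)
        rw [ih, h1, hunion _ _ (htail_meas _) h2, Finset.sum_range_succ, add_assoc]
    have hPtail : Tendsto (fun n => P (tail n)) atTop (𝓝 0) :=
      tendsto_measure_biUnion_Ici_zero_of_pairwise_disjoint
        (fun i => (hf i).nullMeasurableSet) hdisj
    have h0 : Tendsto (fun n => m (tail n)) atTop (𝓝 0) :=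
      tendsto_of_tendsto_of_tendsto_of_le_of_le tendsto_const_nhds (hφ.comp hPtail)
        (fun n => zero_le) fun n => hbound _ (htail_meas n)
    have h3 := (ENNReal.tendsto_nat_tsum fun i => m (f i)).add h0
    rw [add_zero] at h3
    exact tendsto_nhds_unique (tendsto_const_nhds.congr hsplit) h3
  refine ⟨Measure.ofMeasurable (fun s _ => m s) hempty fun f hf hd => hUnion f hf hd,
    fun s hs => ?_⟩
  rw [Measure.ofMeasurable_apply s hs]
  exact hm s

omit [IsFiniteMeasure P] in
/-- It suffices to check an estimate by an `L^p`-norm on simple functions. -/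
theorem lintegral_le_eLpNorm_of_simpleFunc {ν : Measure Z} {C p : ℝ≥0∞}
    (h : ∀ φ : SimpleFunc Z ℝ≥0, ∫⁻ z, φ z ∂ν ≤ C * eLpNorm (fun z => (φ z : ℝ≥0∞)) p P)
    (f : Z → ℝ≥0∞) : ∫⁻ z, f z ∂ν ≤ C * eLpNorm f p P := by
  rw [lintegral_eq_nnreal]
  refine iSup₂_le fun φ hφ => ?_
  rw [← SimpleFunc.lintegral_eq_lintegral]
  refine (h φ).trans ?_
  gcongr
  exact eLpNorm_mono_enorm hφ

theorem tendsto_lintegral_simpleFunc_of_setwise {l : Filter ι} {μ : ι → Measure Z}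
    {ν : Measure Z} (h : ∀ s, MeasurableSet s → Tendsto (fun i => μ i s) l (𝓝 (ν s)))
    (φ : SimpleFunc Z ℝ≥0) :
    Tendsto (fun i => ∫⁻ z, φ z ∂μ i) l (𝓝 (∫⁻ z, φ z ∂ν)) := by
  have key : ∀ μ : Measure Z, ∫⁻ z, φ z ∂μ = ∑ x ∈ φ.range, (x : ℝ≥0∞) * μ (φ ⁻¹' {x}) := by
    intro μ
    rw [← SimpleFunc.map_lintegral, ← SimpleFunc.lintegral_eq_lintegral]
    rfl
  simp_rw [key]
  exact tendsto_finsetSum _ fun x _ =>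
    ENNReal.Tendsto.const_mul (h _ (φ.measurableSet_fiber x)) (Or.inr ENNReal.coe_ne_top)

/-- The converse of Hölder's inequality: a measure that is bounded on `L^p(P)` has a density in
`L^q(P)`. For `q < ∞` the bound is tested on the powers `g ^ (q - 1)` of the truncated densities
`g`, whose `L^q`-norm is finite and can be cancelled. -/
theorem memLp_rnDeriv_of_lintegral_le {ν : Measure Z} [IsFiniteMeasure ν] (hν : ν ≪ P)
    {q : ℝ≥0∞} (hq : 1 < q) {C : ℝ≥0∞} (hC : C ≠ ∞)
    (h : ∀ f : Z → ℝ≥0∞, Measurable f → ∫⁻ z, f z ∂ν ≤ C * eLpNorm f q.conjExponent P) :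
    MemLp (fun z => (ν.rnDeriv P z).toReal) q P := by
  have hmeas := ν.measurable_rnDeriv P
  by_cases hqt : q = ∞
  · subst hqt
    refine memLp_top_of_bound hmeas.ennreal_toReal.aestronglyMeasurable C.toReal ?_
    have h1 : ν.rnDeriv P ≤ᵐ[P] fun _ => C := by
      refine ae_le_of_forall_setLIntegral_le_of_sigmaFinite hmeas fun s hs _ => ?_
      rw [Measure.setLIntegral_rnDeriv hν, setLIntegral_const]
      have h2 := h (s.indicator 1) (measurable_one.indicator hs)
      rw [lintegral_indicator_one hs, show (∞ : ℝ≥0∞).conjExponent = 1 by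
        simp [ENNReal.conjExponent], eLpNorm_one_eq_lintegral_enorm] at h2
      simpa [lintegral_indicator_one hs] using h2
    filter_upwards [h1] with z hz
    rw [Real.norm_of_nonneg ENNReal.toReal_nonneg]
    exact ENNReal.toReal_mono hC hz
  · have hq0 : q ≠ 0 := (zero_lt_one.trans hq).ne'
    have hp0 : q.conjExponent ≠ 0 := (zero_lt_one.trans_le Fact.out).ne'
    have hp := conjExponent_ne_top hq
    have : Fact (1 ≤ q) := ⟨hq.le⟩
    have hconj : q.toReal.HolderConjugate q.conjExponent.toReal :=
      ENNReal.HolderConjugate.toReal (by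
        simpa using (ENNReal.toReal_lt_toReal ENNReal.one_ne_top hqt).2 hq)
    set r := q.toReal with hr
    set p := q.conjExponent.toReal with hpdef
    have hr1 : 1 < r := hconj.lt
    -- the truncated densities
    let g : ℕ → Z → ℝ≥0∞ := fun n z => min (ν.rnDeriv P z) n
    have hg : ∀ n, Measurable (g n) := fun n => hmeas.min measurable_const
    have hgle : ∀ n, ∫⁻ z, g n z ^ r ∂P ≤ C ^ r := by
      intro n
      set I := ∫⁻ z, g n z ^ r ∂P with hI
      have hIt : I ≠ ∞ := by
        have : I ≤ ∫⁻ _, (n : ℝ≥0∞) ^ r ∂P := by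
          refine lintegral_mono fun z => ?_
          gcongr
          exact min_le_right _ _
        refine (this.trans_lt ?_).ne
        rw [lintegral_const]
        exact ENNReal.mul_lt_top (ENNReal.rpow_lt_top_of_nonneg (by linarith) (by simp))
          (measure_lt_top _ _)
      have h1 : I ≤ C * I ^ (1 / p) := by
        calc I ≤ ∫⁻ z, ν.rnDeriv P z * g n z ^ (r - 1) ∂P := by
              refine lintegral_mono fun z => ?_
              have : g n z ^ r = g n z * g n z ^ (r - 1) := by
                conv_lhs => rw [show r = 1 + (r - 1) by ring,
                  ENNReal.rpow_add_of_nonneg _ _ zero_le_one (by linarith), ENNReal.rpow_one]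
              simp only [this]
              gcongr
              exact min_le_left _ _
          _ = ∫⁻ z, g n z ^ (r - 1) ∂ν :=
              lintegral_rnDeriv_mul hν ((hg n).pow_const _).aemeasurable
          _ ≤ C * eLpNorm (fun z => g n z ^ (r - 1)) q.conjExponent P :=
              h _ ((hg n).pow_const _)
          _ = C * I ^ (1 / p) := by
              rw [eLpNorm_eq_lintegral_rpow_enorm_toReal hp0 hp]
              simp_rw [enorm_eq_self, ← ENNReal.rpow_mul]
              rw [← hpdef, hconj.sub_one_mul_conj]
      by_cases hI0 : I = 0
      · rw [hI0]; exact zero_le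
      · have h2 : I = I ^ (1 / r) * I ^ (1 / p) := by
          rw [← ENNReal.rpow_add _ _ hI0 hIt]
          have := hconj.inv_add_inv_eq_one
          simp [this]
        have h3 : I ^ (1 / r) ≤ C := by
          have h4 : I ^ (1 / p) ≠ 0 := by simp [hI0, hIt]
          have h5 : I ^ (1 / p) ≠ ∞ := by
            exact (ENNReal.rpow_lt_top_of_nonneg (by positivity) hIt).ne
          rw [h2] at h1
          exact (ENNReal.mul_le_mul_iff_left h4 h5).1 (h2 ▸ h1)
        calc I = (I ^ (1 / r)) ^ r := by
              rw [← ENNReal.rpow_mul, one_div_mul_cancel (by linarith), ENNReal.rpow_one]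
          _ ≤ C ^ r := by gcongr
    have hle : ∫⁻ z, ν.rnDeriv P z ^ r ∂P ≤ C ^ r := by
      have hmono : ∫⁻ z, ⨆ n, g n z ^ r ∂P = ⨆ n, ∫⁻ z, g n z ^ r ∂P := by
        refine lintegral_iSup (fun n => (hg n).pow_const _) fun n m hnm z => ?_
        simp only [g]
        gcongr
      have hsup : ∀ z, ⨆ n, g n z ^ r = ν.rnDeriv P z ^ r := by
        intro z
        have h1 : Tendsto (fun n : ℕ => g n z) atTop (𝓝 (min (ν.rnDeriv P z) ∞)) :=
          tendsto_const_nhds.min ENNReal.tendsto_nat_nhds_top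
        rw [min_eq_left le_top] at h1
        refine tendsto_nhds_unique (tendsto_atTop_iSup fun n m hnm => ?_)
          ((ENNReal.continuous_rpow_const.tendsto _).comp h1)
        simp only [g]
        gcongr
      simp_rw [hsup] at hmono
      rw [hmono]
      exact iSup_le hgle
    refine ⟨hmeas.ennreal_toReal.aestronglyMeasurable, ?_⟩
    rw [eLpNorm_lt_top_iff_lintegral_rpow_enorm_lt_top hq0 hqt]
    refine lt_of_le_of_lt (le_trans (lintegral_mono fun z => ?_) hle)
      (ENNReal.rpow_lt_top_of_nonneg (by linarith) hC)
    gcongr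
    rw [Real.enorm_of_nonneg ENNReal.toReal_nonneg]
    exact ENNReal.ofReal_toReal_le

end Setwise

/-! ### Weak* compactness of sets of dominated measures -/

section WeakStarCompact
variable {Z : Type*} [MeasurableSpace Z] {q : ℝ≥0∞} [Fact (1 ≤ q)] {P : Measure Z}
  [IsProbabilityMeasure P]

theorem DominatedMeasure.lintegral_simpleFunc_le (Q : DominatedMeasure q P) {K : ℝ}
    (hK : ‖Q.density‖ ≤ K) (φ : SimpleFunc Z ℝ≥0) :
    ∫⁻ z, φ z ∂Q.toMeasure ≤ ENNReal.ofReal (‖pairing q P‖ * K) *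
      eLpNorm (fun z => (φ z : ℝ≥0∞)) q.conjExponent P := by
  have hmem : MemLp (fun z => (φ z : ℝ)) q.conjExponent P :=
    SimpleFunc.memLp_of_isFiniteMeasure (φ.map ((↑) : ℝ≥0 → ℝ)) _ _
  have h1 : ∫⁻ z, φ z ∂Q.toMeasure = ENNReal.ofReal (∫ z, (φ z : ℝ) ∂Q.toMeasure) := by
    rw [ofReal_integral_eq_lintegral_ofReal (Q.integrable_of_memLp hmem)
      (Eventually.of_forall fun z => (φ z).2)]
    simp
  have h2 : eLpNorm (fun z => (φ z : ℝ≥0∞)) q.conjExponent P = ENNReal.ofReal ‖hmem.toLp _‖ := by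
    rw [ofReal_norm, Lp.enorm_toLp]
    refine eLpNorm_congr_enorm_ae (Eventually.of_forall fun z => ?_)
    simp
  rw [h1, h2, ← ENNReal.ofReal_mul' (norm_nonneg _), Q.integral_eq_pairing hmem]
  exact ENNReal.ofReal_le_ofReal ((le_abs_self _).trans (abs_pairing_le hK _))

/-- On norm-bounded families, setwise convergence implies weak* convergence: the functions `Y` for
which the pairings converge are closed in `L^p`, by equicontinuity, and contain indicators. -/
theorem DominatedMeasure.tendsto_pairing_of_setwise (hq : 1 < q) {ι : Type*} {l : Filter ι}
    {F : ι → DominatedMeasure q P} {Q₀ : DominatedMeasure q P} {K : ℝ}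
    (hK : ∀ i, ‖(F i).density‖ ≤ K)
    (h : ∀ s, MeasurableSet s →
      Tendsto (fun i => (F i).toMeasure s) l (𝓝 (Q₀.toMeasure s)))
    (Y : Lp ℝ q.conjExponent P) :
    Tendsto (fun i => pairing q P (F i).density Y) l (𝓝 (pairing q P Q₀.density Y)) := by
  induction Y using Lp.induction (conjExponent_ne_top hq) with
  | indicatorConst c hs hPs =>
    rename_i s
    have key : ∀ Q : DominatedMeasure q P, pairing q P Q.density
        (indicatorConstLp _ hs hPs.ne c) = Q.toMeasure.real s • c := fun Q => by
      rw [← Q.integral_coe_eq_pairing, integral_congr_ae (Q.absCont.ae_le indicatorConstLp_coeFn),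
        integral_indicator hs]
      simp
    simp only [Lp.simpleFunc.coe_indicatorConst, key]
    exact ((ENNReal.tendsto_toReal (measure_ne_top _ s)).comp (h s hs)).smul_const c
  | add hf hg _ h1 h2 =>
    simp only [map_add]
    exact h1.add h2
  | isClosed =>
    refine Equicontinuous.isClosed_setOfPred_tendsto ?_ (pairing q P Q₀.density).continuous
    refine UniformEquicontinuous.equicontinuous (LipschitzWith.uniformEquicontinuous _
      (‖pairing q P‖ * K).toNNReal fun i => ?_)
    refine LipschitzWith.of_dist_le_mul fun Y Y' => ?_
    rw [Real.dist_eq, ← map_sub, dist_eq_norm]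
    exact (abs_pairing_le (hK i) _).trans (by gcongr; exact Real.le_coe_toNNReal _)

/-- Weak* closed, norm-bounded sets of dominated measures are weak* compact. An ultrafilter has a
setwise limit `ν`, the norm bound survives as an estimate of `∫ f dν` by the `L^p`-norm of `f`, so
that `ν` has a density in `L^q`, and the ultrafilter converges weak* to `ν`. The converse of
Hölder's inequality replaces the representation of the dual of `L^p`. -/
theorem compactSpace_of_weakStarClosed (hq : 1 < q) {S : Set (DominatedMeasure q P)}
    (hS : IsClosed[weakStar q P] (DominatedMeasure.density '' S)) {K : ℝ}
    (hK : ∀ Q ∈ S, ‖Q.density‖ ≤ K) : CompactSpace S := by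
  have hp := conjExponent_ne_top hq
  have hp0 : q.conjExponent ≠ 0 := (zero_lt_one.trans_le Fact.out).ne'
  set C : ℝ≥0∞ := ENNReal.ofReal (‖pairing q P‖ * K) with hC
  refine ⟨isCompact_iff_ultrafilter_le_nhds.2 fun 𝒰 _ => ?_⟩
  have hbound : ∀ (Q : S) (φ : SimpleFunc Z ℝ≥0), ∫⁻ z, φ z ∂Q.1.toMeasure ≤
      C * eLpNorm (fun z => (φ z : ℝ≥0∞)) q.conjExponent P := fun Q φ =>
    Q.1.lintegral_simpleFunc_le (hK Q Q.2) φ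
  obtain ⟨ν, hν⟩ := exists_measure_setwise_limit (P := P) 𝒰 (fun Q : S => Q.1.toMeasure)
    (φ := fun t => C * t ^ (1 / q.conjExponent.toReal)) (by
      have h1 : Tendsto (fun t : ℝ≥0∞ => t ^ (1 / q.conjExponent.toReal)) (𝓝 0) (𝓝 0) := by
        have := (ENNReal.continuous_rpow_const (y := 1 / q.conjExponent.toReal)).tendsto 0
        rwa [ENNReal.zero_rpow_of_pos (one_div_pos.2 (ENNReal.toReal_pos hp0 hp))] at this
      simpa using ENNReal.Tendsto.const_mul h1 (Or.inr ENNReal.ofReal_ne_top))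
    (fun Q s hs => by
      have h1 := lintegral_le_eLpNorm_of_simpleFunc (hbound Q) (s.indicator 1)
      rw [lintegral_indicator_one hs] at h1
      refine h1.trans_eq ?_
      have h2 := eLpNorm_indicator_const (μ := P) (c := (1 : ℝ≥0∞)) hs hp0 hp
      simp only [enorm_eq_self, one_mul] at h2
      rw [← h2]
      rfl)
  have hνprob : IsProbabilityMeasure ν :=
    ⟨tendsto_nhds_unique (hν _ MeasurableSet.univ) (by simp)⟩
  have hνP : ν ≪ P := by
    refine Measure.AbsolutelyContinuous.mk fun s hs h0 => ?_
    refine tendsto_nhds_unique (hν s hs) ?_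
    simp [fun Q : S => Q.1.absCont h0]
  have hνbound := lintegral_le_eLpNorm_of_simpleFunc (ν := ν) (P := P) (C := C)
    (p := q.conjExponent) fun φ =>
      le_of_tendsto (tendsto_lintegral_simpleFunc_of_setwise hν φ)
        (Eventually.of_forall fun Q => hbound Q φ)
  let Q₀ : DominatedMeasure q P :=
    ⟨ν, hνprob, hνP,
      memLp_rnDeriv_of_lintegral_le hνP hq ENNReal.ofReal_ne_top fun f _ => hνbound f⟩
  have hlim : Tendsto (fun Q : S => Q.1) 𝒰 (𝓝 Q₀) := by
    rw [DominatedMeasure.isInducing_pairing.tendsto_nhds_iff, tendsto_pi_nhds]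
    exact DominatedMeasure.tendsto_pairing_of_setwise hq (fun Q : S => hK Q Q.2) hν
  have hmem : Q₀.density ∈ DominatedMeasure.density '' S := by
    let _ := weakStar q P
    have hc : Continuous (DominatedMeasure.density (q := q) (P := P)) := continuous_induced_dom
    exact hS.mem_of_tendsto ((hc.tendsto Q₀).comp hlim)
      (Eventually.of_forall fun Q => ⟨Q, Q.2, rfl⟩)
  obtain ⟨Q₁, hQ₁, h⟩ := hmem
  have : Q₁ = Q₀ := DominatedMeasure.pairing_injective (by simp only [h])
  refine ⟨⟨Q₀, this ▸ hQ₁⟩, Set.mem_univ _, ?_⟩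
  exact tendsto_subtype_rng.2 hlim

/-- Pairing with a dense sequence of the separable space `L^p` embeds a weak* compact set into
`ℕ → ℝ`. -/
theorem metrizableSpace_of_compactSpace (hp : q.conjExponent ≠ ∞) [IsSeparable P]
    {S : Set (DominatedMeasure q P)} [CompactSpace S] :
    TopologicalSpace.MetrizableSpace S := by
  have : Fact (q.conjExponent ≠ ∞) := ⟨hp⟩
  have := Lp.SecondCountableTopology (μ := P) (p := q.conjExponent) (E := ℝ)
  let D := TopologicalSpace.denseSeq (Lp ℝ q.conjExponent P)
  let e : S → ℕ → ℝ := fun Q i => pairing q P Q.1.density (D i)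
  have he : Continuous e := continuous_pi fun i =>
    (DominatedMeasure.continuous_pairing _).comp continuous_subtype_val
  have hinj : Function.Injective e := fun Q Q' h => by
    refine Subtype.ext (DominatedMeasure.pairing_injective ?_)
    exact (TopologicalSpace.denseRange_denseSeq _).equalizer (pairing q P Q.1.density).continuous
      (pairing q P Q'.1.density).continuous h
  exact (he.isClosedEmbedding hinj).isEmbedding.metrizableSpace

end WeakStarCompact

/-! ### Maximizing an integral over a set of dominated measures -/

section MeasurableDist

variable {Ω X : Type*} [MeasurableSpace Ω] [PseudoMetricSpace X]
  [TopologicalSpace.SeparableSpace X] [Nonempty X] {F : Ω → X}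

/-- A map into a separable metric space with measurable distance functions is within `ε` of a
measurable map into a fixed dense sequence. -/
theorem exists_measurable_denseSeq_index (hF : ∀ y, Measurable fun ω => dist (F ω) y) {ε : ℝ}
    (hε : 0 < ε) : ∃ i : Ω → ℕ, Measurable i ∧
      ∀ ω, dist (F ω) (TopologicalSpace.denseSeq X (i ω)) < ε := by
  classical
  have hex : ∀ ω, ∃ i, dist (F ω) (TopologicalSpace.denseSeq X i) < ε := fun ω =>
    (TopologicalSpace.denseRange_denseSeq X).exists_dist_lt (F ω) hε
  exact ⟨fun ω => Nat.find (hex ω),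
    measurable_find _ fun i => measurableSet_lt (hF _) measurable_const,
    fun ω => Nat.find_spec (hex ω)⟩

/-- Measurable distance functions make a map into a separable metric space measurable; this is
stated through continuous functions, so that no `σ`-algebra on `L^p` is needed. -/
theorem measurable_comp_of_measurable_dist (hF : ∀ y, Measurable fun ω => dist (F ω) y)
    {φ : X → ℝ} (hφ : Continuous φ) : Measurable fun ω => φ (F ω) := by
  have hpos : ∀ n : ℕ, (0 : ℝ) < 1 / (n + 1) := fun n => Nat.one_div_pos_of_nat
  choose i hi hdist using fun n => exists_measurable_denseSeq_index hF (hpos n)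
  refine measurable_of_tendsto_metrizable (f := fun n ω => φ (TopologicalSpace.denseSeq X (i n ω)))
    (fun n => (measurable_from_nat (f := fun j => φ (TopologicalSpace.denseSeq X j))).comp (hi n))
    (tendsto_pi_nhds.2 fun ω => ?_)
  refine (hφ.tendsto _).comp (tendsto_iff_dist_tendsto_zero.2 ?_)
  refine squeeze_zero (fun _ => dist_nonneg) (fun n => ?_) tendsto_one_div_add_atTop_nhds_zero_nat
  rw [dist_comm]
  exact (hdist n ω).le

end MeasurableDist

theorem measurable_dist_toLp {Ω Z : Type*} [MeasurableSpace Ω] [MeasurableSpace Z]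
    {p : ℝ≥0∞} [Fact (1 ≤ p)] (hp : p ≠ ∞) {P : Measure Z} [SFinite P] {g : Ω → Z → ℝ}
    (hg : Measurable (Function.uncurry g)) (hLp : ∀ ω, MemLp (g ω) p P) (Y : Lp ℝ p P) :
    Measurable fun ω => dist ((hLp ω).toLp (g ω)) Y := by
  have hp0 : p ≠ 0 := (zero_lt_one.trans_le Fact.out).ne'
  have h1 : ∀ ω, dist ((hLp ω).toLp (g ω)) Y =
      ((∫⁻ z, ‖g ω z - Y z‖ₑ ^ p.toReal ∂P) ^ (1 / p.toReal)).toReal := by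
    intro ω
    rw [Lp.dist_def, eLpNorm_congr_ae ((hLp ω).coeFn_toLp.sub (EventuallyEq.refl _ _)),
      eLpNorm_eq_lintegral_rpow_enorm_toReal hp0 hp]
    rfl
  simp_rw [h1]
  refine ((Measurable.lintegral_prod_right' (f := fun y : Ω × Z => ‖g y.1 y.2 - Y y.2‖ₑ ^ p.toReal)
    ?_).pow_const _).ennreal_toReal
  exact ((hg.sub ((Lp.stronglyMeasurable Y).measurable.comp measurable_snd)).enorm).pow_const _

section StageSup

variable {Ω Z : Type*} [MeasurableSpace Ω] [MeasurableSpace Z] {q : ℝ≥0∞} {P : Measure Z}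
  [IsProbabilityMeasure P] {S : Set (DominatedMeasure q P)} {K : ℝ} {g : Ω → Z → ℝ}

omit [IsProbabilityMeasure P] in
/-- The support function of a bounded set of densities is Lipschitz. -/
theorem iSup_pairing_le [Fact (1 ≤ q)] [Nonempty S] (hK : ∀ Q ∈ S, ‖Q.density‖ ≤ K)
    (Y Y' : Lp ℝ q.conjExponent P) :
    ⨆ Q : S, pairing q P Q.1.density Y ≤
      (⨆ Q : S, pairing q P Q.1.density Y') + ‖pairing q P‖ * K * dist Y Y' := by
  refine ciSup_le fun Q => ?_
  have h1 : BddAbove (Set.range fun Q : S => pairing q P Q.1.density Y') :=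
    ⟨‖pairing q P‖ * K * ‖Y'‖, by
      rintro _ ⟨Q, rfl⟩
      exact (le_abs_self _).trans (abs_pairing_le (hK Q Q.2) _)⟩
  have h2 := (le_abs_self _).trans (abs_pairing_le (hK Q Q.2) (Y - Y'))
  have h3 := le_ciSup h1 Q
  rw [map_sub, ← dist_eq_norm] at h2
  linarith

/-- The supremum is the Lipschitz support function of the set of densities, evaluated at the class
of `g ω` in `L^p`. -/
theorem measurable_iSup_integral [IsSeparable P] (hq : 1 < q) [Nonempty S]
    (hK : ∀ Q ∈ S, ‖Q.density‖ ≤ K) (hg : Measurable (Function.uncurry g))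
    (hLp : ∀ ω, MemLp (g ω) q.conjExponent P) :
    Measurable fun ω => ⨆ Q : S, ∫ z, g ω z ∂Q.1.toMeasure := by
  have : Fact (1 ≤ q) := ⟨hq.le⟩
  have hp := conjExponent_ne_top hq
  have : Fact (q.conjExponent ≠ ∞) := ⟨hp⟩
  have := Lp.SecondCountableTopology (μ := P) (p := q.conjExponent) (E := ℝ)
  simp_rw [fun ω (Q : S) => Q.1.integral_eq_pairing (hLp ω)]
  refine measurable_comp_of_measurable_dist (measurable_dist_toLp hp hg hLp)
    (φ := fun Y => ⨆ Q : S, pairing q P Q.1.density Y) ?_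
  refine (LipschitzWith.of_le_add_mul (‖pairing q P‖ * K).toNNReal fun Y Y' => ?_).continuous
  exact (iSup_pairing_le hK Y Y').trans (by gcongr; exact Real.le_coe_toNNReal _)

/-- A measurable `ε`-maximizer with countably many values: on each member of a countable
measurable partition on which `ω ↦ g ω` is nearly constant in `L^p`, one measure serves. -/
theorem exists_measurable_almost_maximizer [IsSeparable P] (hq : 1 < q) [Nonempty S]
    (hK : ∀ Q ∈ S, ‖Q.density‖ ≤ K) (hg : Measurable (Function.uncurry g))
    (hLp : ∀ ω, MemLp (g ω) q.conjExponent P) {ε : ℝ} (hε : 0 < ε) :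
    ∃ s : Ω → S, Measurable s ∧
      ∀ ω, ⨆ Q : S, ∫ z, g ω z ∂Q.1.toMeasure ≤ ∫ z, g ω z ∂(s ω).1.toMeasure + ε := by
  have : Fact (1 ≤ q) := ⟨hq.le⟩
  have hp := conjExponent_ne_top hq
  have : Fact (q.conjExponent ≠ ∞) := ⟨hp⟩
  have := Lp.SecondCountableTopology (μ := P) (p := q.conjExponent) (E := ℝ)
  set C := ‖pairing q P‖ * K
  have hC : 0 ≤ C := by
    obtain ⟨Q⟩ := ‹Nonempty S›
    exact mul_nonneg (ContinuousLinearMap.opNorm_nonneg _) ((norm_nonneg _).trans (hK Q Q.2))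
  obtain ⟨i, hi, hdist⟩ := exists_measurable_denseSeq_index (measurable_dist_toLp hp hg hLp)
    (ε := ε / (4 * (C + 1))) (by positivity)
  have hex : ∀ j, ∃ Q : S, ⨆ Q : S, pairing q P Q.1.density (TopologicalSpace.denseSeq _ j) <
      pairing q P Q.1.density (TopologicalSpace.denseSeq _ j) + ε / 2 := fun j => by
    obtain ⟨Q, hQ⟩ := exists_lt_of_lt_ciSup (sub_lt_self
      (⨆ Q : S, pairing q P Q.1.density (TopologicalSpace.denseSeq _ j)) (half_pos hε))
    exact ⟨Q, by linarith⟩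
  choose s hs using hex
  refine ⟨fun ω => s (i ω), measurable_from_nat.comp hi, fun ω => ?_⟩
  simp_rw [fun ω (Q : S) => Q.1.integral_eq_pairing (hLp ω)]
  set Y := (hLp ω).toLp (g ω)
  set Y' := TopologicalSpace.denseSeq (Lp ℝ q.conjExponent P) (i ω)
  have h1 := iSup_pairing_le hK Y Y'
  have h2 := hs (i ω)
  have h3 := (le_abs_self _).trans (abs_pairing_le (hK _ (s (i ω)).2) (Y' - Y))
  rw [map_sub, ← dist_eq_norm, dist_comm] at h3
  have h4 : C * dist Y Y' ≤ ε / 4 := by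
    calc C * dist Y Y' ≤ (C + 1) * (ε / (4 * (C + 1))) := by
          gcongr
          · linarith
          · exact (hdist ω).le
      _ = ε / 4 := by field_simp
  linarith

/-- On weak* closed sets, which are compact and metrizable, there is a measurable exact
maximizer. -/
theorem exists_measurable_maximizer [IsSeparable P] (hq : 1 < q) [Nonempty S]
    (hS : IsClosed[weakStar q P] (DominatedMeasure.density '' S))
    (hK : ∀ Q ∈ S, ‖Q.density‖ ≤ K) (hg : Measurable (Function.uncurry g))
    (hLp : ∀ ω, MemLp (g ω) q.conjExponent P) :
    ∃ s : Ω → S, Measurable s ∧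
      ∀ ω (Q : S), ∫ z, g ω z ∂Q.1.toMeasure ≤ ∫ z, g ω z ∂(s ω).1.toMeasure := by
  have : Fact (1 ≤ q) := ⟨hq.le⟩
  have hp := conjExponent_ne_top hq
  have : Fact (q.conjExponent ≠ ∞) := ⟨hp⟩
  have := Lp.SecondCountableTopology (μ := P) (p := q.conjExponent) (E := ℝ)
  have := compactSpace_of_weakStarClosed hq hS hK
  have := metrizableSpace_of_compactSpace (S := S) hp
  refine exists_measurable_argmax (u := fun ω (Q : S) => ∫ z, g ω z ∂Q.1.toMeasure)
    (fun Q => ?_) fun ω => ?_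
  · simp_rw [fun ω => Q.1.integral_eq_pairing (hLp ω)]
    exact measurable_comp_of_measurable_dist (measurable_dist_toLp hp hg hLp)
      (pairing q P Q.1.density).continuous
  · simp_rw [fun Q : S => Q.1.integral_eq_pairing (hLp ω)]
    exact (DominatedMeasure.continuous_pairing _).comp continuous_subtype_val

end StageSup

/-! ### The kernels of the decision process -/

namespace Model

variable {E A Z : Type*} [MeasurableSpace E] [MeasurableSpace A] [MeasurableSpace Z]
variable {M : Model E A Z}

instance Policy.isMarkovKernel_kernel (π : M.Policy) (n : ℕ) : IsMarkovKernel (π.kernel n) :=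
  π.isMarkov n

instance NaturePolicy.isMarkovKernel_kernel (γ : M.NaturePolicy) (n : ℕ) :
    IsMarkovKernel (γ.kernel n) :=
  ⟨fun k => (γ.rule n k).1.isProb⟩

theorem measurableSet_sect (n : ℕ) (x : E) : MeasurableSet (M.sect n x) :=
  measurable_prodMk_left (M.measurableSet_D n)

/-- The pair `(h_n, a_n)`, for an action `a_n` admissible in the current state of `h_n`. -/
def pair {n : ℕ} (h : M.Hist n) (a : M.sect n (M.last h)) : M.HistAct n := ⟨(h, a), a.2⟩

theorem measurable_pair {n : ℕ} (h : M.Hist n) : Measurable (pair h) :=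
  (measurable_const.prodMk measurable_subtype_coe).subtype_mk

instance Policy.isProbabilityMeasure_onSect (π : M.Policy) (n : ℕ) (h : M.Hist n) :
    IsProbabilityMeasure (π.onSect n h) := by
  constructor
  rw [Policy.onSect, (MeasurableEmbedding.subtype_coe (measurableSet_sect n _)).comap_apply]
  simpa using π.feasible n h

theorem Policy.actKernel_apply (π : M.Policy) (n : ℕ) (h : M.Hist n) :
    π.actKernel n h = (π.onSect n h).map (pair h) := by
  ext s hs
  have hemb := MeasurableEmbedding.subtype_coe (measurableSet_histAct (M := M) n)
  rw [Measure.map_apply (measurable_pair h) hs, Policy.onSect,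
    (MeasurableEmbedding.subtype_coe (measurableSet_sect n _)).comap_apply, Policy.actKernel,
    Kernel.comapRight_apply' _ _ _ hs, Kernel.id_prod_apply' _ _ (hemb.measurableSet_image.2 hs)]
  congr 1
  ext a
  constructor
  · rintro ⟨⟨⟨h', a'⟩, hk⟩, hks, heq⟩
    cases heq
    exact ⟨⟨a, hk⟩, hks, rfl⟩
  · rintro ⟨a', ha', rfl⟩
    exact ⟨_, ha', rfl⟩

theorem NaturePolicy.stepKernel_apply (γ : M.NaturePolicy) (n : ℕ) (k : M.HistAct n) :
    γ.stepKernel n k =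
      (γ.rule n k).1.toMeasure.map fun z => extend k (M.T n (toD k) z) := by
  have hT : Measurable fun y : M.HistAct n × Z => M.T n (toD y.1) y.2 :=
    (M.measurable_T n).comp ((measurable_toD.comp measurable_fst).prodMk measurable_snd)
  ext s hs
  have h1 : Measurable fun z => M.T n (toD k) z := hT.comp measurable_prodMk_left
  have h2 : Measurable fun x => extend k x := measurable_extend.comp measurable_prodMk_left
  rw [NaturePolicy.stepKernel, NaturePolicy.transition, Kernel.map_apply' _ measurable_extend _ hs,
    Kernel.id_prod_apply' _ _ (measurable_extend hs)]
  change Kernel.map _ _ k ((fun x => extend k x) ⁻¹' s) = _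
  rw [Kernel.map_apply' _ hT _ (h2 hs), Kernel.id_prod_apply' _ _ (hT (h2 hs))]
  exact (Measure.map_apply (h2.comp h1) hs).symm

instance Policy.isMarkovKernel_actKernel (π : M.Policy) (n : ℕ) :
    IsMarkovKernel (π.actKernel n) :=
  ⟨fun h => by
    rw [π.actKernel_apply]
    exact Measure.isProbabilityMeasure_map (measurable_pair h).aemeasurable⟩

theorem measurable_next {n : ℕ} :
    Measurable fun y : M.HistAct n × Z => extend y.1 (M.T n (toD y.1) y.2) :=
  measurable_extend.comp (measurable_fst.prodMk
    ((M.measurable_T n).comp ((measurable_toD.comp measurable_fst).prodMk measurable_snd)))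

instance NaturePolicy.isMarkovKernel_stepKernel (γ : M.NaturePolicy) (n : ℕ) :
    IsMarkovKernel (γ.stepKernel n) :=
  ⟨fun k => by
    rw [γ.stepKernel_apply]
    exact Measure.isProbabilityMeasure_map
      (measurable_next.comp measurable_prodMk_left).aemeasurable⟩

/-- The conditional law of `H_{n+1}` given `H_n = h_n`. -/
def oneStep (π : M.Policy) (γ : M.NaturePolicy) (n : ℕ) : Kernel (M.Hist n) (M.Hist (n + 1)) :=
  γ.stepKernel n ∘ₖ π.actKernel n

instance isMarkovKernel_oneStep (π : M.Policy) (γ : M.NaturePolicy) (n : ℕ) :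
    IsMarkovKernel (oneStep π γ n) := by
  unfold oneStep; infer_instance

instance isMarkovKernel_law (π : M.Policy) (γ : M.NaturePolicy) (n k : ℕ) :
    IsMarkovKernel (law π γ n k) := by
  induction k with
  | zero => exact inferInstanceAs (IsMarkovKernel Kernel.id)
  | succ k ih => exact inferInstanceAs (IsMarkovKernel (oneStep π γ (n + k) ∘ₖ law π γ n k))

theorem law_succ (π : M.Policy) (γ : M.NaturePolicy) (n k : ℕ) :
    law π γ n (k + 1) = oneStep π γ (n + k) ∘ₖ law π γ n k := rfl

theorem lintegral_oneStep (π : M.Policy) (γ : M.NaturePolicy) (n : ℕ) (h : M.Hist n)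
    {f : M.Hist (n + 1) → ℝ≥0∞} (hf : Measurable f) :
    ∫⁻ h', f h' ∂oneStep π γ n h = ∫⁻ a, ∫⁻ z,
      f (extend (pair h a) (M.T n (toD (pair h a)) z))
        ∂(γ.rule n (pair h a)).1.toMeasure ∂π.onSect n h := by
  rw [oneStep, Kernel.lintegral_comp _ _ _ hf, π.actKernel_apply,
    lintegral_map (hf.lintegral_kernel) (measurable_pair h)]
  refine lintegral_congr fun a => ?_
  rw [γ.stepKernel_apply]
  exact lintegral_map hf (measurable_next.comp measurable_prodMk_left)

theorem integral_oneStep (π : M.Policy) (γ : M.NaturePolicy) (n : ℕ) (h : M.Hist n)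
    {f : M.Hist (n + 1) → ℝ} (hf : Measurable f) (hint : Integrable f (oneStep π γ n h)) :
    ∫ h', f h' ∂oneStep π γ n h = ∫ a, ∫ z,
      f (extend (pair h a) (M.T n (toD (pair h a)) z))
        ∂(γ.rule n (pair h a)).1.toMeasure ∂π.onSect n h := by
  rw [oneStep] at hint ⊢
  rw [Kernel.integral_comp hint, π.actKernel_apply,
    integral_map (measurable_pair h).aemeasurable
      (hf.stronglyMeasurable.integral_kernel).aestronglyMeasurable]
  refine integral_congr_ae (Eventually.of_forall fun a => ?_)
  simp only
  rw [γ.stepKernel_apply]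
  exact integral_map (measurable_next.comp measurable_prodMk_left).aemeasurable
    hf.aestronglyMeasurable

/-! ### Costs accumulated along a history -/

@[simp]
theorem last_extend {n : ℕ} (k : M.HistAct n) (x' : E) : M.last (extend k x') = x' := by
  simp [last, extend]

/-- The sum `∑_{n ≤ k < m} φ_k(x_k, a_k, x_{k+1})` along a history `(x_0, a_0, …, x_m)`. -/
def stageSum {R : Type*} [AddCommMonoid R] (φ : ∀ n, M.D n → E → R) (n : ℕ) {m : ℕ}
    (h : M.Hist m) : R :=
  ∑ k ∈ Finset.univ.filter (fun k : Fin m => n ≤ (k : ℕ)),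
    φ k ⟨(h.1.1 k.castSucc, h.1.2 k), h.2 k⟩ (h.1.1 k.succ)

theorem stageSum_self {R : Type*} [AddCommMonoid R] (φ : ∀ n, M.D n → E → R) {n m : ℕ}
    (hmn : m ≤ n) (h : M.Hist m) : stageSum φ n h = 0 := by
  rw [stageSum, Finset.filter_false_of_mem, Finset.sum_empty]
  exact fun k _ => by omega

theorem stageSum_extend {R : Type*} [AddCommMonoid R] (φ : ∀ n, M.D n → E → R) {n m : ℕ}
    (hnm : n ≤ m) (k : M.HistAct m) (x' : E) :
    stageSum φ n (extend k x') = stageSum φ n k.1.1 + φ m (toD k) x' := by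
  have hcongr : ∀ (j : ℕ) (y y' : M.D j) (x x' : E), y.1 = y'.1 → x = x' → φ j y x = φ j y' x' := by
    rintro j y y' x x' h1 rfl
    rw [Subtype.ext h1]
  simp only [stageSum, Finset.sum_filter]
  rw [Fin.sum_univ_castSucc]
  congr 1
  · refine Finset.sum_congr rfl fun j _ => ?_
    refine if_congr Iff.rfl (hcongr _ _ _ _ _ ?_ ?_) rfl
    · simp [extend]
    · simp [extend, ← Fin.castSucc_succ]
  · rw [if_pos (by simpa using hnm)]
    refine hcongr m _ _ _ _ ?_ ?_
    · simp [extend, toD, last]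
    · simp [extend]

theorem measurable_stageSum {R : Type*} [AddCommMonoid R] [MeasurableSpace R] [MeasurableAdd₂ R]
    {φ : ∀ n, M.D n → E → R} {n m : ℕ}
    (hφ : ∀ k < m, Measurable fun y : M.D k × E => φ k y.1 y.2) :
    Measurable (stageSum φ n : M.Hist m → R) := by
  refine Finset.measurable_fun_sum _ fun k _ => ?_
  have h1 : Measurable fun h : M.Hist m =>
      ((⟨(h.1.1 k.castSucc, h.1.2 k), h.2 k⟩ : M.D k), h.1.1 k.succ) := by
    refine Measurable.prodMk (Measurable.subtype_mk (Measurable.prodMk ?_ ?_)) ?_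
    · exact (measurable_pi_apply _).comp (measurable_fst.comp measurable_subtype_coe)
    · exact (measurable_pi_apply _).comp (measurable_snd.comp measurable_subtype_coe)
    · exact (measurable_pi_apply _).comp (measurable_fst.comp measurable_subtype_coe)
  exact (hφ k k.2).comp h1

theorem enorm_stageSum_le (φ : ∀ n, M.D n → E → ℝ) (n : ℕ) {m : ℕ} (h : M.Hist m) :
    ‖stageSum φ n h‖ₑ ≤ stageSum (fun n y x => ‖φ n y x‖ₑ) n h :=
  enorm_sum_le _ _

end Model

/-! ### The bounding function and the stage operators -/

namespace Model

variable {E A Z : Type*} [MeasurableSpace E] [MeasurableSpace A] [MeasurableSpace Z]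

/-- The analytic content of the assumptions: `b ≥ 1` is a measurable bounding function with growth
factor `α`, stage costs are measurable, costs and next-stage bounds are `p`-integrable, and the
densities of the ambiguity sets are bounded by `K`. -/
structure BoundedBy (M : Model E A Z) (b : E → ℝ) (α K : ℝ) : Prop where
  α_nonneg : 0 ≤ α
  measurable_b : Measurable b
  one_le_b : ∀ x, 1 ≤ b x
  measurable_c : ∀ n < M.N, Measurable fun y : M.D n × E => M.c n y.1 y.2
  measurable_cN : Measurable M.cN
  abs_cN_le : ∀ x, |M.cN x| ≤ b x
  lintegral_c_le : ∀ n < M.N, ∀ Q ∈ M.Q (n + 1), ∀ y : M.D n,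
    ∫⁻ z, ‖M.c n y (M.T n y z)‖ₑ ∂Q.toMeasure ≤ ENNReal.ofReal (b y.1.1)
  lintegral_b_le : ∀ n < M.N, ∀ Q ∈ M.Q (n + 1), ∀ y : M.D n,
    ∫⁻ z, ENNReal.ofReal (b (M.T n y z)) ∂Q.toMeasure ≤
      ENNReal.ofReal α * ENNReal.ofReal (b y.1.1)
  memLp_c : ∀ n < M.N, ∀ y : M.D n, MemLp (fun z => M.c n y (M.T n y z)) M.p (M.P (n + 1))
  memLp_b : ∀ n < M.N, ∀ y : M.D n, MemLp (fun z => b (M.T n y z)) M.p (M.P (n + 1))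
  norm_density_le : ∀ n < M.N, ∀ Q ∈ M.Q (n + 1), ‖Q.density‖ ≤ K

theorem exists_boundedBy [TopologicalSpace E] [SecondCountableTopology E] [BorelSpace E]
    [TopologicalSpace A] [SecondCountableTopology A] [BorelSpace A] {M : Model E A Z}
    (hcc : M.ContinuityCompactness) (hb : M.Bounding) :
    ∃ (b : E → ℝ) (α K : ℝ), M.BoundedBy b α K := by
  obtain ⟨α, εl, εu, bl, bu, hα, -, hεl, hεu, hε, hbl, hbu, hbl', hbu', hint, hcN, hdom⟩ :=
    hb.exists_bounds
  obtain ⟨K, hK⟩ := hb.norm_bounded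
  have hc : ∀ n < M.N, Measurable fun y : M.D n × E => M.c n y.1 y.2 := fun n hn =>
    (hcc.lowerSemicontinuous_c n hn).measurable
  have hT : ∀ n (y : M.D n), Measurable (M.T n y) := fun n y =>
    (M.measurable_T n).comp measurable_prodMk_left
  have hadd : ∀ x, ENNReal.ofReal (bu x - bl x) = ENNReal.ofReal (bu x) + ENNReal.ofReal (-bl x) :=
    fun x => by
      rw [sub_eq_add_neg, ENNReal.ofReal_add (hεu.trans (hbu' x)) (by linarith [hbl' x])]
  refine ⟨fun x => bu x - bl x, α, K, hα, hbu.sub hbl, fun x => by linarith [hbl' x, hbu' x], hc,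
    hcc.lowerSemicontinuous_cN.measurable, fun x => ?_, fun n hn Q hQ y => ?_,
    fun n hn Q hQ y => ?_, fun n hn y => ?_, fun n hn y => ?_, hK⟩
  · rw [abs_le]
    constructor <;> linarith [hcN x, hbl' x, hbu' x]
  · obtain ⟨h1, -, h2, -⟩ := hint n hn Q hQ y
    have hm : Measurable fun z => M.c n y (M.T n y z) :=
      (hc n hn).comp (measurable_const.prodMk (hT n y))
    have h3 : ∀ r : ℝ, ‖r‖ₑ ≤ ENNReal.ofReal r + ENNReal.ofReal (-r) := fun r => by
      rw [Real.enorm_eq_ofReal_abs]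
      rcases abs_cases r with ⟨h, -⟩ | ⟨h, -⟩ <;> rw [h]
      exacts [le_self_add, le_add_self]
    calc _ ≤ ∫⁻ z, ENNReal.ofReal (M.c n y (M.T n y z)) + ENNReal.ofReal (-M.c n y (M.T n y z))
            ∂Q.toMeasure := lintegral_mono fun z => h3 _
      _ ≤ _ := by
        rw [lintegral_add_left hm.ennreal_ofReal, hadd]
        exact add_le_add h2 h1
  · obtain ⟨-, h1, -, h2⟩ := hint n hn Q hQ y
    have hm : Measurable fun z => bu (M.T n y z) := hbu.comp (hT n y)
    simp_rw [hadd]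
    rw [lintegral_add_left hm.ennreal_ofReal, mul_add,
      ← ENNReal.ofReal_mul hα, ← ENNReal.ofReal_mul hα]
    exact add_le_add h2 h1
  · obtain ⟨Θ₁, Θ₂, -, -, hΘ₁, hΘ₂, hL₁, hL₂, hle⟩ := hdom n hn y
    exact hL₁.mono ((hc n hn).comp (measurable_const.prodMk (hT n y))).aestronglyMeasurable
      (Eventually.of_forall fun z => (hle.self_of_nhds z).1.trans (le_abs_self _))
  · obtain ⟨Θ₁, Θ₂, -, -, hΘ₁, hΘ₂, hL₁, hL₂, hle⟩ := hdom n hn y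
    refine hL₂.mono ((hbu.sub hbl).comp (hT n y)).aestronglyMeasurable
      (Eventually.of_forall fun z => ?_)
    rw [Real.norm_of_nonneg (by linarith [hbl' (M.T n y z), hbu' (M.T n y z)])]
    exact (hle.self_of_nhds z).2.trans (le_abs_self _)

variable {M : Model E A Z} {b : E → ℝ} {α K : ℝ}

instance nonempty_coe_Q (n : ℕ) : Nonempty (M.Q n) := (M.nonempty_Q n).to_subtype

namespace BoundedBy

variable (hM : M.BoundedBy b α K)
include hM

theorem one_add_mul_nonneg {C : ℝ} (hC : 0 ≤ C) : 0 ≤ 1 + C * α := by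
  have := hM.α_nonneg
  positivity

theorem measurable_costToGo {n : ℕ} (hn : n < M.N) {v : M.Hist (n + 1) → ℝ} (hv : Measurable v) :
    Measurable (Function.uncurry (M.costToGo n v)) :=
  ((hM.measurable_c n hn).comp ((measurable_toD.comp measurable_fst).prodMk
    ((M.measurable_T n).comp ((measurable_toD.comp measurable_fst).prodMk measurable_snd)))).add
    (hv.comp measurable_next)

theorem memLp_costToGo {n : ℕ} (hn : n < M.N) {v : M.Hist (n + 1) → ℝ} (hv : Measurable v) {C : ℝ}
    (hvC : ∀ h, |v h| ≤ C * b (M.last h)) (k : M.HistAct n) :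
    MemLp (M.costToGo n v k) M.p (M.P (n + 1)) := by
  refine (hM.memLp_c n hn (toD k)).add
    (((hM.memLp_b n hn (toD k)).const_mul C).mono
      (hv.comp (measurable_next.comp measurable_prodMk_left)).aestronglyMeasurable
      (Eventually.of_forall fun z => ?_))
  refine (hvC _).trans ?_
  rw [last_extend]
  exact le_abs_self _

theorem integrable_costToGo {n : ℕ} (hn : n < M.N) {v : M.Hist (n + 1) → ℝ} (hv : Measurable v)
    {C : ℝ} (hvC : ∀ h, |v h| ≤ C * b (M.last h)) (k : M.HistAct n) (Q : M.Q (n + 1)) :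
    Integrable (M.costToGo n v k) Q.1.toMeasure := by
  have : Fact (1 ≤ M.q) := ⟨M.one_lt_q.le⟩
  exact Q.1.integrable_of_memLp (hM.memLp_costToGo hn hv hvC k)

/-- One step of the bounding function: `∫ |c_n| + C b dℚ ≤ (1 + C α) b(x_n)`. -/
theorem lintegral_bound_le {n : ℕ} (hn : n < M.N) (C : ℝ≥0∞) (y : M.D n) {Q}
    (hQ : Q ∈ M.Q (n + 1)) :
    ∫⁻ z, (‖M.c n y (M.T n y z)‖ₑ + C * ENNReal.ofReal (b (M.T n y z))) ∂Q.toMeasure ≤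
      (1 + C * ENNReal.ofReal α) * ENNReal.ofReal (b y.1.1) := by
  have hT : Measurable (M.T n y) := (M.measurable_T n).comp measurable_prodMk_left
  have hm : Measurable fun z => M.c n y (M.T n y z) :=
    (hM.measurable_c n hn).comp (measurable_const.prodMk hT)
  have hbT : Measurable fun z => b (M.T n y z) := hM.measurable_b.comp hT
  rw [lintegral_add_left hm.enorm, lintegral_const_mul _ hbT.ennreal_ofReal, add_mul, one_mul,
    mul_assoc]
  gcongr
  · exact hM.lintegral_c_le n hn Q hQ y
  · exact hM.lintegral_b_le n hn Q hQ y

theorem abs_stageValue_le {n : ℕ} (hn : n < M.N) {v : M.Hist (n + 1) → ℝ} {C : ℝ} (hC : 0 ≤ C)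
    (hvC : ∀ h, |v h| ≤ C * b (M.last h)) (k : M.HistAct n) (Q : M.Q (n + 1)) :
    |M.stageValue n v k Q| ≤ (1 + C * α) * b (M.last k.1.1) := by
  have hb0 := zero_le_one.trans (hM.one_le_b (M.last k.1.1))
  have hr : (1 + ENNReal.ofReal C * ENNReal.ofReal α) * ENNReal.ofReal (b (M.last k.1.1)) =
      ENNReal.ofReal ((1 + C * α) * b (M.last k.1.1)) := by
    rw [ENNReal.ofReal_mul (hM.one_add_mul_nonneg hC),
      ENNReal.ofReal_add zero_le_one (mul_nonneg hC hM.α_nonneg), ENNReal.ofReal_mul hC,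
      ENNReal.ofReal_one]
  have h1 : ∫⁻ z, ‖M.costToGo n v k z‖ₑ ∂Q.1.toMeasure ≤
      ENNReal.ofReal ((1 + C * α) * b (M.last k.1.1)) := by
    rw [← hr]
    refine (lintegral_mono fun z => (enorm_add_le _ _).trans ?_).trans
      (hM.lintegral_bound_le hn (ENNReal.ofReal C) (toD k) Q.2)
    gcongr
    rw [← ENNReal.ofReal_mul hC, Real.enorm_eq_ofReal_abs]
    refine ENNReal.ofReal_le_ofReal ((hvC _).trans_eq ?_)
    rw [last_extend]
  have h2 := (enorm_integral_le_lintegral_enorm (M.costToGo n v k)).trans h1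
  rw [Real.enorm_eq_ofReal_abs] at h2
  exact (ENNReal.ofReal_le_ofReal_iff (mul_nonneg (hM.one_add_mul_nonneg hC) hb0)).1 h2

theorem bddAbove_stageValue {n : ℕ} (hn : n < M.N) {v : M.Hist (n + 1) → ℝ} {C : ℝ} (hC : 0 ≤ C)
    (hvC : ∀ h, |v h| ≤ C * b (M.last h)) (k : M.HistAct n) :
    BddAbove (Set.range (M.stageValue n v k)) :=
  ⟨_, by
    rintro _ ⟨Q, rfl⟩
    exact (le_abs_self _).trans (hM.abs_stageValue_le hn hC hvC k Q)⟩

theorem abs_iSup_stageValue_le {n : ℕ} (hn : n < M.N) {v : M.Hist (n + 1) → ℝ} {C : ℝ}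
    (hC : 0 ≤ C) (hvC : ∀ h, |v h| ≤ C * b (M.last h)) (k : M.HistAct n) :
    |⨆ Q, M.stageValue n v k Q| ≤ (1 + C * α) * b (M.last k.1.1) := by
  obtain ⟨Q⟩ := nonempty_coe_Q (M := M) (n + 1)
  refine abs_le.2 ⟨(abs_le.1 (hM.abs_stageValue_le hn hC hvC k Q)).1.trans
    (le_ciSup (hM.bddAbove_stageValue hn hC hvC k) Q), ciSup_le fun Q => ?_⟩
  exact (le_abs_self _).trans (hM.abs_stageValue_le hn hC hvC k Q)

theorem measurable_iSup_stageValue {n : ℕ} (hn : n < M.N) [IsSeparable (M.P (n + 1))]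
    {v : M.Hist (n + 1) → ℝ} (hv : Measurable v) {C : ℝ}
    (hvC : ∀ h, |v h| ≤ C * b (M.last h)) :
    Measurable fun k => ⨆ Q, M.stageValue n v k Q :=
  measurable_iSup_integral M.one_lt_q (hM.norm_density_le n hn) (hM.measurable_costToGo hn hv)
    (hM.memLp_costToGo hn hv hvC)

theorem integrable_iSup_stageValue {n : ℕ} (hn : n < M.N) [IsSeparable (M.P (n + 1))]
    {v : M.Hist (n + 1) → ℝ} (hv : Measurable v) {C : ℝ} (hC : 0 ≤ C)
    (hvC : ∀ h, |v h| ≤ C * b (M.last h)) (π : M.Policy) (h : M.Hist n) :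
    Integrable (fun a => ⨆ Q, M.stageValue n v (pair h a) Q) (π.onSect n h) :=
  Integrable.of_bound
    ((hM.measurable_iSup_stageValue hn hv hvC).comp (measurable_pair h)).aestronglyMeasurable
    ((1 + C * α) * b (M.last h))
    (Eventually.of_forall fun a => hM.abs_iSup_stageValue_le hn hC hvC (pair h a))

theorem measurable_stageValue_rule {n : ℕ} (hn : n < M.N) {v : M.Hist (n + 1) → ℝ}
    (hv : Measurable v) (γ : M.NaturePolicy) :
    Measurable fun k => M.stageValue n v k (γ.rule n k) :=
  ((hM.measurable_costToGo hn hv).stronglyMeasurable.integral_kernel_prod_right'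
    (κ := γ.kernel n)).measurable

theorem integrable_stageValue_rule {n : ℕ} (hn : n < M.N)
    {v : M.Hist (n + 1) → ℝ} (hv : Measurable v) {C : ℝ} (hC : 0 ≤ C)
    (hvC : ∀ h, |v h| ≤ C * b (M.last h)) (π : M.Policy) (γ : M.NaturePolicy) (h : M.Hist n) :
    Integrable (fun a => M.stageValue n v (pair h a) (γ.rule n (pair h a))) (π.onSect n h) := by
  have hm := hM.measurable_stageValue_rule hn hv γ
  exact Integrable.of_bound (hm.comp (measurable_pair h)).aestronglyMeasurable
    ((1 + C * α) * b (M.last h))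
    (Eventually.of_forall fun a => hM.abs_stageValue_le hn hC hvC (pair h a) _)

theorem opNature_le_op {n : ℕ} (hn : n < M.N) [IsSeparable (M.P (n + 1))]
    {v : M.Hist (n + 1) → ℝ} (hv : Measurable v) {C : ℝ} (hC : 0 ≤ C)
    (hvC : ∀ h, |v h| ≤ C * b (M.last h)) (π : M.Policy) (γ : M.NaturePolicy) (h : M.Hist n) :
    π.opNature γ n v h ≤ π.op n v h :=
  integral_mono (hM.integrable_stageValue_rule hn hv hC hvC π γ h)
    (hM.integrable_iSup_stageValue hn hv hC hvC π h)
    fun a => le_ciSup (hM.bddAbove_stageValue hn hC hvC (pair h a)) _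

theorem op_le_opNature_add {n : ℕ} (hn : n < M.N) [IsSeparable (M.P (n + 1))]
    {v : M.Hist (n + 1) → ℝ} (hv : Measurable v) {C : ℝ} (hC : 0 ≤ C)
    (hvC : ∀ h, |v h| ≤ C * b (M.last h)) (π : M.Policy) {γ : M.NaturePolicy} {ε : ℝ}
    (hγ : ∀ k, ⨆ Q, M.stageValue n v k Q ≤ M.stageValue n v k (γ.rule n k) + ε)
    (h : M.Hist n) : π.op n v h ≤ π.opNature γ n v h + ε := by
  have h1 := hM.integrable_stageValue_rule hn hv hC hvC π γ h
  have h2 : π.opNature γ n v h + ε =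
      ∫ a, (M.stageValue n v (pair h a) (γ.rule n (pair h a)) + ε) ∂π.onSect n h := by
    rw [integral_add h1 (integrable_const ε), integral_const, probReal_univ, one_smul]
    rfl
  rw [h2]
  exact integral_mono (hM.integrable_iSup_stageValue hn hv hC hvC π h)
    (h1.add (integrable_const ε)) fun a => hγ (pair h a)

theorem abs_op_le {n : ℕ} (hn : n < M.N) {v : M.Hist (n + 1) → ℝ} {C : ℝ} (hC : 0 ≤ C)
    (hvC : ∀ h, |v h| ≤ C * b (M.last h)) (π : M.Policy) (h : M.Hist n) :
    |π.op n v h| ≤ (1 + C * α) * b (M.last h) := by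
  have h1 := norm_integral_le_of_norm_le_const (μ := π.onSect n h)
    (f := fun a => ⨆ Q, M.stageValue n v (pair h a) Q) (C := (1 + C * α) * b (M.last h))
    (Eventually.of_forall fun a => hM.abs_iSup_stageValue_le hn hC hvC (pair h a))
  rwa [probReal_univ, mul_one] at h1

theorem abs_opNature_le {n : ℕ} (hn : n < M.N) {v : M.Hist (n + 1) → ℝ} {C : ℝ} (hC : 0 ≤ C)
    (hvC : ∀ h, |v h| ≤ C * b (M.last h)) (π : M.Policy) (γ : M.NaturePolicy) (h : M.Hist n) :
    |π.opNature γ n v h| ≤ (1 + C * α) * b (M.last h) := by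
  have h1 := norm_integral_le_of_norm_le_const (μ := π.onSect n h)
    (f := fun a => M.stageValue n v (pair h a) (γ.rule n (pair h a)))
    (C := (1 + C * α) * b (M.last h))
    (Eventually.of_forall fun a => hM.abs_stageValue_le hn hC hvC (pair h a) _)
  rwa [probReal_univ, mul_one] at h1

theorem measurable_opNature {n : ℕ} (hn : n < M.N) {v : M.Hist (n + 1) → ℝ} (hv : Measurable v)
    (π : M.Policy) (γ : M.NaturePolicy) : Measurable (π.opNature γ n v) := by
  have hm := hM.measurable_stageValue_rule hn hv γ
  have h1 : π.opNature γ n v =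
      fun h => ∫ k, M.stageValue n v k (γ.rule n k) ∂π.actKernel n h := by
    funext h
    rw [π.actKernel_apply, integral_map (measurable_pair h).aemeasurable hm.aestronglyMeasurable]
    rfl
  rw [h1]
  exact hm.stronglyMeasurable.integral_kernel.measurable

theorem measurable_op {n : ℕ} (hn : n < M.N) [IsSeparable (M.P (n + 1))]
    {v : M.Hist (n + 1) → ℝ} (hv : Measurable v) {C : ℝ}
    (hvC : ∀ h, |v h| ≤ C * b (M.last h)) (π : M.Policy) : Measurable (π.op n v) := by
  have hm := hM.measurable_iSup_stageValue hn hv hvC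
  have h1 : π.op n v = fun h => ∫ k, ⨆ Q, M.stageValue n v k Q ∂π.actKernel n h := by
    funext h
    rw [π.actKernel_apply, integral_map (measurable_pair h).aemeasurable hm.aestronglyMeasurable]
    rfl
  rw [h1]
  exact hm.stronglyMeasurable.integral_kernel.measurable

end BoundedBy

end Model

namespace Model

variable {E A Z : Type*} [MeasurableSpace E] [MeasurableSpace A] [MeasurableSpace Z]
variable {M : Model E A Z} {b : E → ℝ} {α K : ℝ}

/-! ### Accumulated costs under the law of the process -/

namespace BoundedBy

variable (hM : M.BoundedBy b α K)
include hM

theorem measurable_stageSum_enorm {n m : ℕ} (hm : m ≤ M.N) :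
    Measurable (stageSum (fun n y x => ‖M.c n y x‖ₑ) n : M.Hist m → ℝ≥0∞) :=
  measurable_stageSum fun k hk => (hM.measurable_c k (hk.trans_le hm)).enorm

theorem measurable_stageSum_c {n m : ℕ} (hm : m ≤ M.N) :
    Measurable (stageSum M.c n : M.Hist m → ℝ) :=
  measurable_stageSum fun k hk => hM.measurable_c k (hk.trans_le hm)

theorem measurable_stageSum_add_b {n m : ℕ} (hm : m ≤ M.N) (C : ℝ≥0∞) :
    Measurable fun h : M.Hist m =>
      stageSum (fun n y x => ‖M.c n y x‖ₑ) n h + C * ENNReal.ofReal (b (M.last h)) :=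
  (hM.measurable_stageSum_enorm hm).add
    ((hM.measurable_b.comp M.measurable_last).ennreal_ofReal.const_mul C)

/-- One step of the process replaces the weight `C` of the bounding function by `1 + C α`. -/
theorem lintegral_oneStep_le {n m : ℕ} (hnm : n ≤ m) (hm : m < M.N) (π : M.Policy)
    (γ : M.NaturePolicy) (C : ℝ≥0∞) (h : M.Hist m) :
    ∫⁻ h', (stageSum (fun n y x => ‖M.c n y x‖ₑ) n h' + C * ENNReal.ofReal (b (M.last h')))
      ∂oneStep π γ m h ≤ stageSum (fun n y x => ‖M.c n y x‖ₑ) n h +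
        (1 + C * ENNReal.ofReal α) * ENNReal.ofReal (b (M.last h)) := by
  rw [lintegral_oneStep π γ m h (hM.measurable_stageSum_add_b hm C)]
  have h1 : ∀ a, ∫⁻ z, (stageSum (fun n y x => ‖M.c n y x‖ₑ) n
        (extend (pair h a) (M.T m (toD (pair h a)) z)) + C * ENNReal.ofReal (b (M.last
          (extend (pair h a) (M.T m (toD (pair h a)) z)))))
        ∂(γ.rule m (pair h a)).1.toMeasure ≤ stageSum (fun n y x => ‖M.c n y x‖ₑ) n h +
        (1 + C * ENNReal.ofReal α) * ENNReal.ofReal (b (M.last h)) := fun a => by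
    simp_rw [stageSum_extend _ hnm, last_extend, add_assoc]
    rw [lintegral_add_left measurable_const, lintegral_const, measure_univ, mul_one]
    exact add_le_add le_rfl (hM.lintegral_bound_le hm C (toD (pair h a)) (γ.rule m (pair h a)).2)
  refine (lintegral_mono h1).trans_eq ?_
  rw [lintegral_const, measure_univ, mul_one]

/-- Absolute costs have finite expectation. The induction on the number of steps needs every weight
`C`, as a step turns `C` into `1 + C α`. -/
theorem lintegral_law_lt_top (π : M.Policy) (γ : M.NaturePolicy) (n : ℕ) (h : M.Hist n) (k : ℕ)
    (hk : n + k ≤ M.N) (C : ℝ≥0∞) (hC : C ≠ ∞) :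
    ∫⁻ h', (stageSum (fun n y x => ‖M.c n y x‖ₑ) n h' + C * ENNReal.ofReal (b (M.last h')))
      ∂law π γ n k h < ∞ := by
  induction k generalizing C with
  | zero =>
    have h1 := hM.measurable_stageSum_add_b (n := n) hk C
    change ∫⁻ h', _ ∂(Kernel.id (α := M.Hist n) h) < ∞
    rw [Kernel.id_apply]
    refine (lintegral_dirac' _ h1).trans_lt ?_
    rw [stageSum_self _ le_rfl, zero_add]
    exact ENNReal.mul_lt_top hC.lt_top ENNReal.ofReal_lt_top
  | succ k ih =>
    have h1 := hM.measurable_stageSum_add_b (n := n) hk C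
    rw [law_succ]
    refine (Kernel.lintegral_comp _ _ _ h1).trans_lt ?_
    refine (lintegral_mono fun h' =>
      hM.lintegral_oneStep_le (Nat.le_add_right n k) (by omega) π γ C h').trans_lt ?_
    exact ih (by omega) _ (by finiteness)

omit hM in
theorem enorm_stageSum_add_le {m : ℕ} {v : M.Hist m → ℝ} {C : ℝ} (hC : 0 ≤ C)
    (hvC : ∀ h, |v h| ≤ C * b (M.last h)) (n : ℕ) (h : M.Hist m) :
    ‖stageSum M.c n h + v h‖ₑ ≤ stageSum (fun n y x => ‖M.c n y x‖ₑ) n h +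
      ENNReal.ofReal C * ENNReal.ofReal (b (M.last h)) := by
  refine (enorm_add_le _ _).trans (add_le_add (enorm_stageSum_le _ _ _) ?_)
  rw [← ENNReal.ofReal_mul hC, Real.enorm_eq_ofReal_abs]
  exact ENNReal.ofReal_le_ofReal (hvC h)

theorem integrable_law (π : M.Policy) (γ : M.NaturePolicy) (n : ℕ) (h : M.Hist n) (k : ℕ)
    (hk : n + k ≤ M.N) {v : M.Hist (n + k) → ℝ} (hv : Measurable v) {C : ℝ} (hC : 0 ≤ C)
    (hvC : ∀ h, |v h| ≤ C * b (M.last h)) :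
    Integrable (fun h' => stageSum M.c n h' + v h') (law π γ n k h) :=
  ⟨((hM.measurable_stageSum_c hk).add hv).aestronglyMeasurable,
    (lintegral_mono fun h' => enorm_stageSum_add_le hC hvC n h').trans_lt
      (hM.lintegral_law_lt_top π γ n h k hk _ ENNReal.ofReal_ne_top)⟩

theorem integral_oneStep_eq {n m : ℕ} (hnm : n ≤ m) (hm : m < M.N) (π : M.Policy)
    (γ : M.NaturePolicy) {v : M.Hist (m + 1) → ℝ} (hv : Measurable v) {C : ℝ} (hC : 0 ≤ C)
    (hvC : ∀ h, |v h| ≤ C * b (M.last h)) (h : M.Hist m)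
    (hfin : stageSum (fun n y x => ‖M.c n y x‖ₑ) n h ≠ ∞) :
    ∫ h', (stageSum M.c n h' + v h') ∂oneStep π γ m h = stageSum M.c n h + π.opNature γ m v h := by
  have hmeas : Measurable fun h' : M.Hist (m + 1) => stageSum M.c n h' + v h' :=
    (hM.measurable_stageSum_c hm).add hv
  have hint : Integrable (fun h' => stageSum M.c n h' + v h') (oneStep π γ m h) :=
    ⟨hmeas.aestronglyMeasurable,
      ((lintegral_mono fun h' => enorm_stageSum_add_le hC hvC n h').trans
        (hM.lintegral_oneStep_le hnm hm π γ _ h)).trans_lt (by finiteness)⟩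
  rw [integral_oneStep π γ m h hmeas hint]
  have h1 : ∀ a, ∫ z, (stageSum M.c n (extend (pair h a) (M.T m (toD (pair h a)) z)) +
      v (extend (pair h a) (M.T m (toD (pair h a)) z))) ∂(γ.rule m (pair h a)).1.toMeasure =
      stageSum M.c n h + M.stageValue m v (pair h a) (γ.rule m (pair h a)) := fun a => by
    simp_rw [stageSum_extend _ hnm, add_assoc]
    refine (integral_add (integrable_const _)
      (hM.integrable_costToGo hm hv hvC (pair h a) _)).trans ?_
    rw [integral_const, probReal_univ, one_smul]
    rfl
  simp_rw [h1]
  rw [integral_add (integrable_const _) (hM.integrable_stageValue_rule hm hv hC hvC π γ h),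
    integral_const, probReal_univ, one_smul]
  rfl

/-- Conditioning on the last but one history replaces `v` by `𝒯_{nπ_nγ_n} v`. As the law of the
process is built forward in time, values are compared along this recursion instead of by backward
induction. -/
theorem integral_law_succ (π : M.Policy) (γ : M.NaturePolicy) (n : ℕ) (h : M.Hist n) (k : ℕ)
    (hk : n + k < M.N) {v : M.Hist (n + k + 1) → ℝ} (hv : Measurable v) {C : ℝ} (hC : 0 ≤ C)
    (hvC : ∀ h, |v h| ≤ C * b (M.last h)) :
    ∫ h', (stageSum M.c n h' + v h') ∂law π γ n (k + 1) h =
      ∫ h', (stageSum M.c n h' + π.opNature γ (n + k) v h') ∂law π γ n k h := by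
  have h1 : Integrable (fun h' => stageSum M.c n h' + v h')
      ((oneStep π γ (n + k) ∘ₖ law π γ n k) h) := hM.integrable_law π γ n h (k + 1) hk hv hC hvC
  rw [law_succ]
  refine (Kernel.integral_comp h1).trans (integral_congr_ae (Eventually.of_forall fun h' => ?_))
  refine hM.integral_oneStep_eq (Nat.le_add_right n k) hk π γ hv hC hvC h' ?_
  exact (ENNReal.sum_lt_top.2 fun _ _ => enorm_lt_top).ne

end BoundedBy

/-! ### The robust cost iteration -/

/-- The value `J_m` of the robust cost iteration, `j` steps before it is stopped with the terminal
cost: `J = 𝒯_{mπ_m} ⋯ 𝒯_{m+j-1,π_{m+j-1}} c_N`. It is used with `m + j = N`. -/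
def iterValue (π : M.Policy) : ∀ (_ m : ℕ), M.Hist m → ℝ
  | 0, _ => fun h => M.cN (M.last h)
  | j + 1, m => π.op m (iterValue π j (m + 1))

/-- The value `J_m = 𝒯_{mπ_m} ⋯ 𝒯_{N-1,π_{N-1}} c_N` of the robust cost iteration at stage `m`. -/
def optValue (π : M.Policy) (m : ℕ) : M.Hist m → ℝ := iterValue π (M.N - m) m

theorem optValue_of_le (π : M.Policy) {m : ℕ} (hm : M.N ≤ m) (h : M.Hist m) :
    optValue π m h = M.cN (M.last h) := by
  rw [optValue, Nat.sub_eq_zero_of_le hm]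
  rfl

theorem optValue_of_lt (π : M.Policy) {m : ℕ} (hm : m < M.N) :
    optValue π m = π.op m (optValue π (m + 1)) := by
  rw [optValue, show M.N - m = (M.N - (m + 1)) + 1 by omega]
  rfl

namespace BoundedBy

variable (hM : M.BoundedBy b α K) (hsep : ∀ n < M.N, IsSeparable (M.P (n + 1)))
include hM hsep

theorem iterValue_bound (π : M.Policy) (j m : ℕ) (hjm : m + j ≤ M.N) :
    Measurable (iterValue π j m) ∧
      ∃ C : ℝ, 0 ≤ C ∧ ∀ h, |iterValue π j m h| ≤ C * b (M.last h) := by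
  induction j generalizing m with
  | zero =>
    exact ⟨hM.measurable_cN.comp M.measurable_last, 1, zero_le_one, fun h => by
      rw [one_mul]; exact hM.abs_cN_le _⟩
  | succ j ih =>
    obtain ⟨hv, C, hC, hvC⟩ := ih (m + 1) (by omega)
    have hm : m < M.N := by omega
    have := hsep m hm
    exact ⟨hM.measurable_op hm hv hvC π, 1 + C * α, hM.one_add_mul_nonneg hC,
      hM.abs_op_le hm hC hvC π⟩

theorem measurable_optValue (π : M.Policy) {m : ℕ} (hm : m ≤ M.N) : Measurable (optValue π m) :=
  (hM.iterValue_bound hsep π _ m (by omega)).1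

theorem exists_abs_optValue_le (π : M.Policy) {m : ℕ} (hm : m ≤ M.N) :
    ∃ C : ℝ, 0 ≤ C ∧ ∀ h, |optValue π m h| ≤ C * b (M.last h) :=
  (hM.iterValue_bound hsep π _ m (by omega)).2

omit hM hsep in
theorem integral_law_zero_optValue (π : M.Policy) (γ : M.NaturePolicy) {n : ℕ} (h : M.Hist n)
    (hm : Measurable fun h' : M.Hist n => stageSum M.c n h' + optValue π n h') :
    ∫ h', (stageSum M.c n h' + optValue π (n + 0) h') ∂law π γ n 0 h = optValue π n h := by
  change ∫ h', (stageSum M.c n h' + optValue π n h') ∂(Kernel.id (α := M.Hist n) h) = _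
  rw [Kernel.id_apply, integral_dirac' _ _ hm.stronglyMeasurable, stageSum_self _ le_rfl, zero_add]

omit hM hsep in
/-- At the horizon the value to go is the terminal cost. -/
theorem value_eq_integral_optValue (π : M.Policy) (γ : M.NaturePolicy) {n : ℕ} (hn : n ≤ M.N)
    (h : M.Hist n) : π.value γ n h =
      ∫ h', (stageSum M.c n h' + optValue π (n + (M.N - n)) h') ∂law π γ n (M.N - n) h := by
  refine integral_congr_ae (Eventually.of_forall fun h' => ?_)
  simp only [optValue_of_le π (show M.N ≤ n + (M.N - n) by omega)]
  rfl

theorem integrable_law_optValue (π : M.Policy) (γ : M.NaturePolicy) (n : ℕ) (h : M.Hist n) (k : ℕ)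
    (hk : n + k ≤ M.N) :
    Integrable (fun h' => stageSum M.c n h' + optValue π (n + k) h') (law π γ n k h) := by
  obtain ⟨C, hC, hvC⟩ := hM.exists_abs_optValue_le hsep π hk
  exact hM.integrable_law π γ n h k hk (hM.measurable_optValue hsep π hk) hC hvC

/-- Along the process, accumulated cost plus robust value to go is a supermartingale under every
policy of nature. -/
theorem integral_law_succ_optValue_le (π : M.Policy) (γ : M.NaturePolicy) (n : ℕ) (h : M.Hist n)
    (k : ℕ) (hk : n + k < M.N) :
    ∫ h', (stageSum M.c n h' + optValue π (n + (k + 1)) h') ∂law π γ n (k + 1) h ≤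
      ∫ h', (stageSum M.c n h' + optValue π (n + k) h') ∂law π γ n k h := by
  obtain ⟨C, hC, hvC⟩ := hM.exists_abs_optValue_le hsep π (m := n + k + 1) hk
  have hv := hM.measurable_optValue hsep π (m := n + k + 1) hk
  have := hsep _ hk
  refine (hM.integral_law_succ π γ n h k hk hv hC hvC).trans_le ?_
  refine integral_mono (hM.integrable_law π γ n h k hk.le (hM.measurable_opNature hk hv π γ)
    (hM.one_add_mul_nonneg hC) (hM.abs_opNature_le hk hC hvC π γ))
    (hM.integrable_law_optValue hsep π γ n h k hk.le) fun h' => ?_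
  simp only [optValue_of_lt π hk]
  exact add_le_add le_rfl (hM.opNature_le_op hk hv hC hvC π γ h')

/-- Under decision rules of nature that lose at most `ε` at every stage, the supermartingale
decreases by at most `ε` in expectation. -/
theorem integral_law_optValue_le_succ_add (π : M.Policy) {γ : M.NaturePolicy} {ε : ℝ}
    (hγ : ∀ m < M.N, ∀ h, optValue π m h ≤ π.opNature γ m (optValue π (m + 1)) h + ε)
    (n : ℕ) (h : M.Hist n) (k : ℕ) (hk : n + k < M.N) :
    ∫ h', (stageSum M.c n h' + optValue π (n + k) h') ∂law π γ n k h ≤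
      ∫ h', (stageSum M.c n h' + optValue π (n + (k + 1)) h') ∂law π γ n (k + 1) h + ε := by
  obtain ⟨C, hC, hvC⟩ := hM.exists_abs_optValue_le hsep π (m := n + k + 1) hk
  have hv := hM.measurable_optValue hsep π (m := n + k + 1) hk
  have hint := hM.integrable_law π γ n h k hk.le (hM.measurable_opNature hk hv π γ)
    (hM.one_add_mul_nonneg hC) (hM.abs_opNature_le hk hC hvC π γ)
  have h1 : ∫ h', (stageSum M.c n h' + optValue π (n + (k + 1)) h') ∂law π γ n (k + 1) h + ε =
      ∫ h', (stageSum M.c n h' + π.opNature γ (n + k) (optValue π (n + k + 1)) h' + ε)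
        ∂law π γ n k h := by
    rw [integral_add hint (integrable_const ε), integral_const, probReal_univ, one_smul]
    exact congrArg (· + ε) (hM.integral_law_succ π γ n h k hk hv hC hvC)
  rw [h1]
  refine integral_mono (hM.integrable_law_optValue hsep π γ n h k hk.le)
    (hint.add (integrable_const ε)) fun h' => ?_
  have h2 := hγ (n + k) hk h'
  simp only
  linarith

theorem value_le_optValue (π : M.Policy) (γ : M.NaturePolicy) {n : ℕ} (hn : n ≤ M.N)
    (h : M.Hist n) : π.value γ n h ≤ optValue π n h := by
  have key : ∀ k, n + k ≤ M.N →
      ∫ h', (stageSum M.c n h' + optValue π (n + k) h') ∂law π γ n k h ≤ optValue π n h := by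
    intro k hk
    induction k with
    | zero =>
      exact (integral_law_zero_optValue π γ h
        ((hM.measurable_stageSum_c hn).add (hM.measurable_optValue hsep π hn))).le
    | succ k ih =>
      exact (hM.integral_law_succ_optValue_le hsep π γ n h k (by omega)).trans (ih (by omega))
  rw [value_eq_integral_optValue π γ hn h]
  exact key _ (by omega)

theorem optValue_le_value_add (π : M.Policy) {γ : M.NaturePolicy} {ε : ℝ}
    (hγ : ∀ m < M.N, ∀ h, optValue π m h ≤ π.opNature γ m (optValue π (m + 1)) h + ε)
    {n : ℕ} (hn : n ≤ M.N) (h : M.Hist n) :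
    optValue π n h ≤ π.value γ n h + (M.N - n : ℕ) * ε := by
  have key : ∀ k : ℕ, n + k ≤ M.N → optValue π n h ≤
      ∫ h', (stageSum M.c n h' + optValue π (n + k) h') ∂law π γ n k h + k * ε := by
    intro k hk
    induction k with
    | zero =>
      rw [integral_law_zero_optValue π γ h
        ((hM.measurable_stageSum_c hn).add (hM.measurable_optValue hsep π hn))]
      simp
    | succ k ih =>
      have h1 := hM.integral_law_optValue_le_succ_add hsep π hγ n h k (by omega)
      have h2 := ih (by omega)
      push_cast
      linarith
  rw [value_eq_integral_optValue π γ hn h]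
  exact key _ (by omega)

omit hM hsep in
/-- Decision rules chosen stage by stage form a policy of nature; after the horizon any rule will
do. -/
theorem exists_naturePolicy {p : ∀ n, (M.HistAct n → M.Q (n + 1)) → Prop}
    (hp : ∀ n < M.N, ∃ s : M.HistAct n → M.Q (n + 1), Measurable s ∧ p n s) :
    ∃ γ : M.NaturePolicy, ∀ n < M.N, p n (γ.rule n) := by
  have h1 : ∀ n, ∃ s : M.HistAct n → M.Q (n + 1), Measurable s ∧ (n < M.N → p n s) := by
    intro n
    by_cases hn : n < M.N
    · obtain ⟨s, hs, hps⟩ := hp n hn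
      exact ⟨s, hs, fun _ => hps⟩
    · obtain ⟨Q⟩ := nonempty_coe_Q (M := M) (n + 1)
      exact ⟨fun _ => Q, measurable_const, fun h => absurd h hn⟩
  choose s hs hps using h1
  exact ⟨⟨s, hs⟩, hps⟩

/-- One policy of nature is `ε`-optimal at all stages and histories at once: it loses at most
`ε / (N + 1)` at every stage. -/
theorem exists_almost_optimal (π : M.Policy) {ε : ℝ} (hε : 0 < ε) :
    ∃ γ : M.NaturePolicy, ∀ n ≤ M.N, ∀ h : M.Hist n, optValue π n h ≤ π.value γ n h + ε := by
  set δ : ℝ := ε / (M.N + 1) with hδ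
  have hδ0 : 0 < δ := by positivity
  obtain ⟨γ, hγ⟩ := exists_naturePolicy (M := M) (p := fun n s => ∀ k,
      ⨆ Q, M.stageValue n (optValue π (n + 1)) k Q ≤
        M.stageValue n (optValue π (n + 1)) k (s k) + δ) fun n hn => by
    obtain ⟨C, hC, hvC⟩ := hM.exists_abs_optValue_le hsep π (m := n + 1) hn
    have hv := hM.measurable_optValue hsep π (m := n + 1) hn
    have := hsep n hn
    exact exists_measurable_almost_maximizer M.one_lt_q (hM.norm_density_le n hn)
      (hM.measurable_costToGo hn hv) (hM.memLp_costToGo hn hv hvC) hδ0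
  refine ⟨γ, fun n hn h => ?_⟩
  have h1 := hM.optValue_le_value_add hsep π (γ := γ) (ε := δ) (fun m hm h => by
    obtain ⟨C, hC, hvC⟩ := hM.exists_abs_optValue_le hsep π (m := m + 1) hm
    have hv := hM.measurable_optValue hsep π (m := m + 1) hm
    have := hsep m hm
    rw [optValue_of_lt π hm]
    exact hM.op_le_opNature_add hm hv hC hvC π (hγ m hm) h) hn h
  have h2 : ((M.N - n : ℕ) : ℝ) * δ ≤ ε := by
    have h3 : ((M.N - n : ℕ) : ℝ) ≤ M.N + 1 := by
      have : M.N - n ≤ M.N + 1 := by omega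
      exact_mod_cast this
    calc ((M.N - n : ℕ) : ℝ) * δ ≤ (M.N + 1) * δ := by gcongr
      _ = ε := by rw [hδ]; field_simp
  linarith

theorem bddAbove_value (π : M.Policy) {n : ℕ} (hn : n ≤ M.N) (h : M.Hist n) :
    BddAbove (Set.range fun γ : M.NaturePolicy => π.value γ n h) :=
  ⟨_, by
    rintro _ ⟨γ, rfl⟩
    exact hM.value_le_optValue hsep π γ hn h⟩

/-- The robust value is computed by the robust cost iteration. -/
theorem robustValue_eq_optValue (π : M.Policy) {n : ℕ} (hn : n ≤ M.N) :
    (π.robustValue n : M.Hist n → ℝ) = optValue π n := by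
  funext h
  obtain ⟨γ, -⟩ := hM.exists_almost_optimal hsep π one_pos
  have : Nonempty M.NaturePolicy := ⟨γ⟩
  refine le_antisymm (ciSup_le fun γ => hM.value_le_optValue hsep π γ hn h)
    (le_of_forall_pos_le_add fun ε hε => ?_)
  obtain ⟨γ, hγ⟩ := hM.exists_almost_optimal hsep π hε
  exact (hγ n hn h).trans (add_le_add (le_ciSup (hM.bddAbove_value hsep π hn h) γ) le_rfl)

theorem exists_maximizing_naturePolicy (π : M.Policy)
    (hcl : ∀ n < M.N, M.WeakStarClosed (n + 1)) :
    ∃ γ : M.NaturePolicy, ∀ n < M.N, ∀ (k : M.HistAct n) (Q : M.Q (n + 1)),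
      M.stageValue n (optValue π (n + 1)) k Q ≤
        M.stageValue n (optValue π (n + 1)) k (γ.rule n k) := by
  refine exists_naturePolicy (M := M) (p := fun n s => ∀ (k : M.HistAct n) (Q : M.Q (n + 1)),
    M.stageValue n (optValue π (n + 1)) k Q ≤
      M.stageValue n (optValue π (n + 1)) k (s k)) fun n hn => ?_
  obtain ⟨C, hC, hvC⟩ := hM.exists_abs_optValue_le hsep π (m := n + 1) hn
  have hv := hM.measurable_optValue hsep π (m := n + 1) hn
  have := hsep n hn
  exact exists_measurable_maximizer M.one_lt_q (hcl n hn) (hM.norm_density_le n hn)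
    (hM.measurable_costToGo hn hv) (hM.memLp_costToGo hn hv hvC)

end BoundedBy

end Model

end RobustMDP

end

theorem mainTheorem2 {E A Z : Type*}
    [TopologicalSpace E] [TopologicalSpace.MetrizableSpace E] [SecondCountableTopology E]
    [MeasurableSpace E] [BorelSpace E] [StandardBorelSpace E]
    [TopologicalSpace A] [TopologicalSpace.MetrizableSpace A] [SecondCountableTopology A]
    [MeasurableSpace A] [BorelSpace A] [StandardBorelSpace A]
    [MeasurableSpace Z] (M : RobustMDP.Model E A Z)
    (hsep : ∀ n < M.N, MeasureTheory.IsSeparable (M.P (n + 1)))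
    (hcc : M.ContinuityCompactness) (hb : M.Bounding) (π : M.Policy) :
    -- all suprema and integrals below are finite
    (∀ n ≤ M.N, ∀ h : M.Hist n,
      (∀ γ : M.NaturePolicy, Integrable (M.totalCost n)
        (RobustMDP.Model.law π γ n (M.N - n) h)) ∧
      BddAbove (Set.range fun γ : M.NaturePolicy => π.value γ n h)) ∧
    (∀ n < M.N, ∀ h : M.Hist n,
      (∀ a : M.sect n (M.last h),
        (∀ Q : M.Q (n + 1), Integrable
          (M.costToGo n (π.robustValue (n + 1)) ⟨(h, a), a.2⟩)
          Q.1.toMeasure) ∧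
        BddAbove (Set.range (M.stageValue n
          (π.robustValue (n + 1)) ⟨(h, a), a.2⟩))) ∧
      Integrable (fun a : M.sect n (M.last h) =>
        ⨆ Q : M.Q (n + 1), M.stageValue n
          (π.robustValue (n + 1)) ⟨(h, a), a.2⟩ Q) (π.onSect n h)) ∧
    -- measurability and the robust cost iteration
    (∀ n ≤ M.N, Measurable (π.robustValue n : M.Hist n → ℝ)) ∧
    (∀ h : M.Hist M.N, π.robustValue M.N h = M.cN (M.last h)) ∧
    (∀ n < M.N, ∀ h : M.Hist n, π.robustValue n h =
      π.op n (π.robustValue (n + 1)) h) ∧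
    -- optimal responses of nature
    ((∀ n < M.N, M.WeakStarClosed (n + 1)) →
      (∃ γ : M.NaturePolicy, ∀ n < M.N,
        (∀ (k : M.HistAct n) (Q : M.Q (n + 1)),
          M.stageValue n (π.robustValue (n + 1)) k Q ≤
            M.stageValue n (π.robustValue (n + 1)) k
              (γ.rule n k)) ∧
        ∀ h : M.Hist n,
          π.opNature γ n (π.robustValue (n + 1)) h =
            π.op n (π.robustValue (n + 1)) h) ∧
      (∀ γ : M.NaturePolicy,
        (∀ n < M.N, ∀ h : M.Hist n,
          π.opNature γ n (π.robustValue (n + 1)) h =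
            π.op n (π.robustValue (n + 1)) h) →
        ∀ n < M.N, ∀ h : M.Hist n,
          π.robustValue n h = π.value γ n h)) := by
  obtain ⟨b, α, K, hM⟩ := RobustMDP.Model.exists_boundedBy hcc hb
  have hW : ∀ n ≤ M.N, (π.robustValue n : M.Hist n → ℝ) = RobustMDP.Model.optValue π n :=
    fun n hn => hM.robustValue_eq_optValue hsep π hn
  refine ⟨fun n hn h => ⟨fun γ => ?_, hM.bddAbove_value hsep π hn h⟩, fun n hn h => ?_,
    fun n hn => ?_, fun h => ?_, fun n hn h => ?_, fun hcl => ⟨?_, fun γ hγ n hn h => ?_⟩⟩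
  · have h1 := hM.integrable_law π γ n h (M.N - n) (by omega)
      (hM.measurable_cN.comp M.measurable_last) zero_le_one
      (fun h => by rw [one_mul]; exact hM.abs_cN_le _)
    exact h1
  · have := hsep n hn
    obtain ⟨C, hC, hvC⟩ := hM.exists_abs_optValue_le hsep π (m := n + 1) hn
    have hv := hM.measurable_optValue hsep π (m := n + 1) hn
    rw [hW (n + 1) hn]
    exact ⟨fun a => ⟨fun Q => hM.integrable_costToGo hn hv hvC (RobustMDP.Model.pair h a) Q,
      hM.bddAbove_stageValue hn hC hvC (RobustMDP.Model.pair h a)⟩,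
      hM.integrable_iSup_stageValue hn hv hC hvC π h⟩
  · rw [hW n hn]
    exact hM.measurable_optValue hsep π hn
  · rw [hW M.N le_rfl, RobustMDP.Model.optValue_of_le π le_rfl]
  · rw [hW n hn.le, hW (n + 1) hn, RobustMDP.Model.optValue_of_lt π hn]
  · obtain ⟨γ, hγ⟩ := hM.exists_maximizing_naturePolicy hsep π hcl
    refine ⟨γ, fun n hn => ?_⟩
    rw [hW (n + 1) hn]
    refine ⟨hγ n hn, fun h => integral_congr_ae (Eventually.of_forall fun a => ?_)⟩
    obtain ⟨C, hC, hvC⟩ := hM.exists_abs_optValue_le hsep π (m := n + 1) hn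
    exact le_antisymm (le_ciSup (hM.bddAbove_stageValue hn hC hvC (RobustMDP.Model.pair h a)) _)
      (ciSup_le fun Q => hγ n hn (RobustMDP.Model.pair h a) Q)
  · rw [hW n hn.le]
    refine le_antisymm ?_ (hM.value_le_optValue hsep π γ hn.le h)
    have h1 := hM.optValue_le_value_add hsep π (γ := γ) (ε := 0) (fun m hm h => by
      have h2 := hγ m hm h
      rw [hW (m + 1) hm] at h2
      rw [RobustMDP.Model.optValue_of_lt π hm, h2, add_zero]) hn.le h
    rwa [mul_zero, add_zero] at h1
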